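/- Let $S$ be a Polish space with its Borel $\sigma$-algebra, $\pi$ a probability measure on $S$, and $\mathfrak{s}\colon S\to S$ a measurable involution ($\mathfrak{s}\circ\mathfrak{s}=\mathrm{id}$) with $\pi(A)=\pi(\mathfrak{s}(A))$ for all Borel $A$. Let $\mu$ be a rate kernel on $S$, that is, a kernel from $S$ to $S$ whose total rate $\lambda(a)=\mu(a,S)$ is finite for every $a\in S$, and suppose that $\int_S\lambda(a)\,\pi(\mathrm{d}a)<\infty$. Suppose that $$\int_{S\times S} f(b)\,\pi(\mathrm{d}a)\,\mu(a,\mathrm{d}b)=\int_{S\times S} f(\mathfrak{s}(b'))\,\pi(\mathrm{d}b')\,\mu(b',\mathrm{d}a')$$ for all bounded measurable $f\colon S\to\mathbb{R}$, and that $\lambda(a)=\lambda(\mathfrak{s}(a))$ for all $a\in S$. Then there are a rate kernel $\mu'$ on $S$ with $\mu'(a,\cdot)=\mu(a,\cdot)$ for $\pi$-almost every $a$, and a non-explosive time-homogeneous Markov jump process $(Z_t)_{t\ge0}$ with rate kernel $\mu'$, with laws $\Pr_a$, $a\in S$ ($Z_0=a$ $\Pr_a$-almost surely, for every $a\in S$),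 which has $\pi$ as a stationary measure: $$\int_S \Pr_a(Z_t\in B)\,\pi(\mathrm{d}a)=\pi(B)\qquad\text{for all } t\ge0 \text{ and all Borel } B\subseteq S.$$ Here, a non-explosive Markov jump process with rate kernel $\mu'$ is a time-homogeneous Markov process whose paths are, under every $\Pr_a$, almost surely right-continuous and constant except at isolated jumps, and which almost surely satisfies $Z_t=Y_n$ for $\tau_n\le t<\tau_{n+1}$, where $Y$ is a Markov chain started at $a$ with transition kernel $\kappa'(x,\cdot)=\mu'(x,\cdot)/\lambda'(x)$ if $\lambda'(x)=\mu'(x,S)>0$ and $\kappa'(x,\cdot)=\delta_x$ otherwise, $\tau_n=\sum_{k<n}\gamma_k/\lambda'(Y_k)$ (with $\gamma/0=\infty$ for $\gamma>0$) for independent standard exponential variables $\gamma_0,\gamma_1,\dots$ that are independent of $Y$, and $\tau_n\to\infty$ almost surely. -/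

import Mathlib

open MeasureTheory ProbabilityTheory Topology Filter
open scoped ENNReal NNReal

universe u

namespace JumpProcess

variable {S Ω : Type*} [MeasurableSpace S] [MeasurableSpace Ω]

/-- The total jump rate `λ(a) = μ(a, S)` of a kernel `μ`. -/
noncomputable def totalRate (μ : Kernel S S) (a : S) : ℝ≥0∞ := μ a Set.univ

/-- A rate kernel: the total rate is finite at every point (it need not be bounded). -/
def IsRateKernel (μ : Kernel S S) : Prop := ∀ a, totalRate μ a < ∞

/-- The half skew-balance identity
`∫ f(b) π(da) μ(a, db) = ∫ f(𝔰(b')) π(db') μ(b', da')` for all bounded measurable `f`. -/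
def HalfSkewBalance (π : Measure S) (𝔰 : S → S) (μ : Kernel S S) : Prop :=
  ∀ f : S → ℝ, Measurable f → (∃ C : ℝ, ∀ x, |f x| ≤ C) →
    ∫ a, (∫ b, f b ∂(μ a)) ∂π = ∫ b', (∫ _a', f (𝔰 b') ∂(μ b')) ∂π

lemma measurable_totalRate (μ : Kernel S S) : Measurable (totalRate μ) :=
  μ.measurable_coe MeasurableSet.univ

open Classical in
/-- The jump kernel `κ`: `κ(a, B) = μ(a, B) / λ(a)` where `λ(a) ≠ 0`, and `κ(a, ·) = δ_a` at the
absorbing points, where `λ(a) = 0`. -/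
noncomputable def jumpKernel (μ : Kernel S S) : Kernel S S where
  toFun a := if totalRate μ a = 0 then Measure.dirac a else (totalRate μ a)⁻¹ • μ a
  measurable' := by
    refine Measurable.ite (measurable_totalRate μ (measurableSet_singleton 0))
      Measure.measurable_dirac ?_
    refine Measure.measurable_of_measurable_coe _ fun B hB => ?_
    simp only [Measure.smul_apply, smul_eq_mul]
    exact (measurable_totalRate μ).inv.mul (μ.measurable_coe hB)

/-- The σ-algebra generated by `X u`, `u ≤ s`. -/
abbrev pastSigma {ι : Type*} [Preorder ι] (X : ι → Ω → S) (s : ι) : MeasurableSpace Ω :=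
  ⨆ u : ι, ⨆ _ : u ≤ s, MeasurableSpace.comap (X u) inferInstance

/-- `Y` is, under `Q`, a time-homogeneous Markov chain with transition kernel `κ` started at `a`. -/
structure IsMarkovChainFrom (κ : Kernel S S) (a : S) (Q : Measure Ω) (Y : ℕ → Ω → S) : Prop where
  measurable : ∀ n, Measurable (Y n)
  start : ∀ᵐ ω ∂Q, Y 0 ω = a
  step : ∀ n, ∀ B : Set S, MeasurableSet B →
    Q⟦Y (n + 1) ⁻¹' B | pastSigma Y n⟧ =ᵐ[Q] fun ω => (κ (Y n ω)).real B

/-- The jump times `τ_n = ∑_{k < n} γ_k / λ(Y_k)` of the embedded chain `Y` with normalized holding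
times `γ`. The value is `∞` once the chain has reached a point where `λ` vanishes (for `γ_k > 0`). -/
noncomputable def jumpTime (μ : Kernel S S) (Y : ℕ → Ω → S) (γ : ℕ → Ω → ℝ) (n : ℕ) (ω : Ω) :
    ℝ≥0∞ :=
  ∑ k ∈ Finset.range n, ENNReal.ofReal (γ k ω) / totalRate μ (Y k ω)

/-- Jumps and holding times: under each `P a`, the sequence `Y` is a Markov chain
with the jump kernel of `μ` started at `a`, the `γ k` are independent standard exponential
variables, independent of `Y`, and `Z` sits at `Y n` during `[τ_n, τ_{n+1})`. Hence, given that `Z`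
is at `a` after a jump, the time to the next jump is exponential of rate `λ(a)` and the
position after it has law `κ(a, ·)`. -/
structure HasJumpHoldStructure (μ : Kernel S S) (P : Kernel S Ω) (Z : ℝ≥0 → Ω → S)
    (Y : ℕ → Ω → S) (γ : ℕ → Ω → ℝ) : Prop where
  chain : ∀ a, IsMarkovChainFrom (jumpKernel μ) a (P a) Y
  measurable_hold : ∀ k, Measurable (γ k)
  hold_law : ∀ a k, (P a).map (γ k) = expMeasure 1
  hold_indep : ∀ a, iIndepFun γ (P a)
  indep : ∀ a, IndepFun (fun ω k => γ k ω) (fun ω n => Y n ω) (P a)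
  eq_chain : ∀ a, ∀ᵐ ω ∂(P a), ∀ (n : ℕ) (t : ℝ≥0),
    jumpTime μ Y γ n ω ≤ (t : ℝ≥0∞) → (t : ℝ≥0∞) < jumpTime μ Y γ (n + 1) ω → Z t ω = Y n ω

/-- `Z` is, under the laws `P a` (`a ∈ S` the starting point), a non-explosive time-homogeneous
Markov jump process on `S` with rate kernel `μ`. -/
structure IsNonexplosiveMarkovJumpProcess (μ : Kernel S S) (P : Kernel S Ω)
    (Z : ℝ≥0 → Ω → S) : Prop where
  isMarkovKernel : IsMarkovKernel P
  measurable : ∀ t, Measurable (Z t)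
  start : ∀ a, ∀ᵐ ω ∂(P a), Z 0 ω = a
  /-- Paths are right-continuous and constant except at isolated jumps: locally constant to the
  right at each time, and constant on a left neighbourhood of each time. -/
  paths : ∀ a, ∀ᵐ ω ∂(P a), ∀ t : ℝ≥0,
    (∀ᶠ r in 𝓝[≥] t, Z r ω = Z t ω) ∧ ∃ b : S, ∀ᶠ r in 𝓝[<] t, Z r ω = b
  /-- The time-homogeneous Markov property. -/
  markov : ∀ (a : S) (s t : ℝ≥0) (B : Set S), MeasurableSet B →
    (P a)⟦Z (s + t) ⁻¹' B | pastSigma Z s⟧ =ᵐ[P a] fun ω => (P (Z s ω)).real (Z t ⁻¹' B)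
  /-- The rate kernel is `μ`, and the jump times do not accumulate. -/
  rates : ∃ (Y : ℕ → Ω → S) (γ : ℕ → Ω → ℝ), HasJumpHoldStructure μ P Z Y γ ∧
    ∀ a, ∀ᵐ ω ∂(P a), Tendsto (fun n => jumpTime μ Y γ n ω) atTop (𝓝 ∞)

/-- `π` is a stationary measure: `∫ ℙ(Z_t ∈ B | Z_0 = a) π(da) = π(B)` for all `t` and `B`. -/
def IsStationary (π : Measure S) (P : Kernel S Ω) (Z : ℝ≥0 → Ω → S) : Prop :=
  ∀ (t : ℝ≥0) (B : Set S), MeasurableSet B → ∫⁻ a, P a (Z t ⁻¹' B) ∂π = π B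

end JumpProcess

/-! Everything rests on one balance relation. Testing the skew-balance identity on indicators, and
using that `π` and `λ` are both invariant under `𝔰`, gives `∫ μ(a, B) π(da) = ∫_B λ dπ`: under `π`,
jumps land in `B` at the same rate as they leave points of `B` (`balanced_of_halfSkewBalance`).

Non-explosion. Let `ζ` be the explosion time, `h(a) = E_a exp(-ζ)`, and `m(a) < 1` the mean of
`exp(-γ/λ(a))`. Conditioning on the first jump, `h = m · κh`, so `λh = m · μh`. Balance then gives
`∫ μh dπ = ∫ λh dπ = ∫ m · μh dπ`. These integrals are finite because `λ` is integrable, so `m < 1`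
forces `μh = 0`, and hence `h = 0`, `π`-almost everywhere (`explosionDecay_ae_eq_zero`). Making the
points with `h > 0` absorbing changes `μ` on a `π`-null set only, preserves balance, and removes
explosion from every starting point (`explosionDecay_nonexplosive`).

Stationarity. With `p_r(a) = P_a(Z_r ∈ B)`, the exponential law of the first holding time gives the
integrated backward equation `p_T + λ ∫₀ᵀ p_r dr = 1_B + ∫₀ᵀ μp_r dr` (`transProb_backward`).
Integrated against `π`, the two time integrals agree by balance and are finite, so they cancel
(`lintegral_transProb_eq`).

The process. The jump kernel is realised as the law of `φ(a, U)` with `U` uniform, so i.i.d. noise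
drives the trajectory. Dropping the first noise variables restarts the same model at the new state.
The Markov property at time `s` follows by induction on the number of jumps before `s`, with
memorylessness of the exponential law as base case (`window_markov`). -/

namespace JumpProcess

open scoped unitInterval

/-! ### Driving noise and the standard exponential law -/

section Noise

/-- The source of all renewal arguments: the tail of an i.i.d. sequence has the law of the whole and
is independent of the head. It is checked for the inverse map `e`, on finite-dimensional boxes. -/
lemma infinitePi_map_cons {X : Type*} [MeasurableSpace X] (m : Measure X)
    [IsProbabilityMeasure m] :
    (Measure.infinitePi fun _ : ℕ => m).map (fun x => (x 0, fun n => x (n + 1))) =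
      m.prod (Measure.infinitePi fun _ : ℕ => m) := by
  let e : X × (ℕ → X) → (ℕ → X) := fun p n => Nat.casesOn n p.1 p.2
  have he : Measurable e := by
    refine measurable_pi_lambda _ fun n => ?_
    cases n with
    | zero => exact measurable_fst
    | succ n => exact (measurable_pi_apply n).comp measurable_snd
  have key : (m.prod (Measure.infinitePi fun _ : ℕ => m)).map e =
      Measure.infinitePi fun _ : ℕ => m := by
    classical
    refine Measure.eq_infinitePi _ fun s t ht => ?_
    -- Boxes over `s` are padded with full factors to boxes over an initial segment, so that
    -- coordinate `0` can always be split off.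
    let t' : ℕ → Set X := fun i => if i ∈ s then t i else Set.univ
    have ht' : ∀ i, MeasurableSet (t' i) := fun i => by
      by_cases h : i ∈ s <;> simp [t', h, ht i]
    obtain ⟨N, hN⟩ := s.exists_nat_subset_range
    have hpi : Set.pi (s : Set ℕ) t = Set.pi (Finset.range (N + 1) : Set ℕ) t' := by
      ext x
      simp only [Set.mem_pi, Finset.mem_coe, Finset.mem_range, t']
      constructor
      · intro h i _
        by_cases hi : i ∈ s
        · simpa [hi] using h i hi
        · simp [hi]
      · intro h i hi
        have := h i (by have := Finset.mem_range.1 (hN hi); omega)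
        simpa [hi] using this
    have hprod : ∏ i ∈ s, m (t i) = ∏ i ∈ Finset.range (N + 1), m (t' i) := by
      rw [← Finset.prod_subset (s₁ := s) (s₂ := Finset.range (N + 1)) (f := fun i => m (t' i))]
      · exact Finset.prod_congr rfl fun i hi => by simp [t', hi]
      · intro i hi
        have := Finset.mem_range.1 (hN hi)
        exact Finset.mem_range.2 (by omega)
      · intro i _ hi
        simp [t', hi]
    have hpre : e ⁻¹' (Set.pi (Finset.range (N + 1) : Set ℕ) t') =
        t' 0 ×ˢ Set.pi (Finset.range N : Set ℕ) (fun i => t' (i + 1)) := by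
      ext p
      simp only [Set.mem_preimage, Set.mem_pi, Finset.mem_coe, Finset.mem_range, Set.mem_prod]
      constructor
      · intro h
        exact ⟨h 0 (by omega), fun i hi => h (i + 1) (by omega)⟩
      · rintro ⟨h0, h1⟩ i hi
        cases i with
        | zero => exact h0
        | succ i => exact h1 i (by omega)
    rw [hpi, hprod, Measure.map_apply he (MeasurableSet.pi (Finset.countable_toSet _)
      fun i _ => ht' i), hpre, Measure.prod_prod, Measure.infinitePi_pi _ fun i _ => ht' _,
      Finset.prod_range_succ', mul_comm]
  have hd : Measurable fun x : ℕ → X => (x 0, fun n => x (n + 1)) := by fun_prop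
  rw [← key, Measure.map_map hd he]
  have : (fun x : ℕ → X => (x 0, fun n => x (n + 1))) ∘ e = id := rfl
  rw [this, Measure.map_id, key]

instance : IsProbabilityMeasure (expMeasure 1) := isProbabilityMeasure_expMeasure one_pos

/-- The law of the driving noise: independent uniform and standard exponential variables. -/
noncomputable def noiseLaw : Measure ((ℕ → I) × (ℕ → ℝ)) :=
  (Measure.infinitePi fun _ => (volume : Measure I)).prod
    (Measure.infinitePi fun _ => expMeasure 1)

instance : IsProbabilityMeasure noiseLaw := by unfold noiseLaw; infer_instance

lemma lintegral_noiseLaw {F : (I × ℝ) × ((ℕ → I) × (ℕ → ℝ)) → ℝ≥0∞} (hF : Measurable F) :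
    ∫⁻ q, F ((q.1 0, q.2 0), (fun n => q.1 (n + 1), fun n => q.2 (n + 1))) ∂noiseLaw =
      ∫⁻ g, ∫⁻ u, ∫⁻ q, F ((u, g), q) ∂noiseLaw ∂volume ∂(expMeasure 1) := by
  have h1 : (noiseLaw).map (Prod.map (fun x : ℕ → I => (x 0, fun n => x (n + 1)))
      (fun x : ℕ → ℝ => (x 0, fun n => x (n + 1)))) =
      ((volume : Measure I).prod (Measure.infinitePi fun _ : ℕ => (volume : Measure I))).prod
        ((expMeasure 1).prod (Measure.infinitePi fun _ : ℕ => expMeasure 1)) := by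
    unfold noiseLaw
    rw [← Measure.map_prod_map _ _ (by fun_prop) (by fun_prop), infinitePi_map_cons,
      infinitePi_map_cons]
  let F' : (I × (ℕ → I)) × (ℝ × (ℕ → ℝ)) → ℝ≥0∞ := fun p => F ((p.1.1, p.2.1), (p.1.2, p.2.2))
  have hF' : Measurable F' := by fun_prop
  calc _ = ∫⁻ p, F' p ∂((noiseLaw).map (Prod.map (fun x : ℕ → I => (x 0, fun n => x (n + 1)))
      (fun x : ℕ → ℝ => (x 0, fun n => x (n + 1))))) := by
        rw [lintegral_map hF' (by fun_prop)]; rfl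
    _ = ∫⁻ u, ∫⁻ U, ∫⁻ g, ∫⁻ G, F ((u, g), (U, G)) ∂(Measure.infinitePi fun _ => expMeasure 1)
          ∂(expMeasure 1) ∂(Measure.infinitePi fun _ => (volume : Measure I)) ∂volume := by
        rw [h1, lintegral_prod _ hF'.aemeasurable, lintegral_prod]
        · refine lintegral_congr fun u => lintegral_congr fun U => ?_
          rw [lintegral_prod]
          exact (hF'.comp measurable_prodMk_left).aemeasurable
        · exact hF'.lintegral_prod_right'.aemeasurable
    _ = ∫⁻ u, ∫⁻ g, ∫⁻ q, F ((u, g), q) ∂noiseLaw ∂(expMeasure 1) ∂volume := by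
        refine lintegral_congr fun u => ?_
        rw [lintegral_lintegral_swap]
        · refine lintegral_congr fun g => ?_
          unfold noiseLaw
          rw [lintegral_prod]
          exact (hF.comp measurable_prodMk_left).aemeasurable
        · refine Measurable.aemeasurable ?_
          refine Measurable.lintegral_prod_right' (f := fun p : ((ℕ → I) × ℝ) × (ℕ → ℝ) =>
            F ((u, p.1.2), (p.1.1, p.2))) ?_
          fun_prop
    _ = _ := by
        rw [lintegral_lintegral_swap]
        refine Measurable.aemeasurable ?_
        refine Measurable.lintegral_prod_right' (f := fun p : (I × ℝ) × _ => F p) hF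

lemma lintegral_expMeasure {F : ℝ → ℝ≥0∞} (hF : Measurable F) :
    ∫⁻ x, F x ∂(expMeasure 1) = ∫⁻ x in Set.Ioi 0, ENNReal.ofReal (Real.exp (-x)) * F x := by
  have hpdf : Measurable (gammaPDF 1 1) := (measurable_gammaPDFReal 1 1).ennreal_ofReal
  unfold expMeasure gammaMeasure
  rw [lintegral_withDensity_eq_lintegral_mul _ hpdf hF,
    ← lintegral_indicator measurableSet_Ioi, lintegral_congr_ae]
  -- The density is nonzero at `0`, which `Ioi 0` excludes.
  filter_upwards [compl_mem_ae_iff.2 (measure_singleton (0 : ℝ))] with x hx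
  have hx : x ≠ 0 := hx
  have := exponentialPDF_eq 1 x
  unfold exponentialPDF exponentialPDFReal at this
  by_cases h : 0 < x
  · simp [gammaPDF, this, h, h.le]
  · have : ¬ (0 ≤ x) := fun h' => h (lt_of_le_of_ne h' hx.symm)
    simp_all [gammaPDF]

lemma ae_pos_expMeasure : ∀ᵐ g ∂(expMeasure 1), 0 < g := by
  rw [ae_iff, ← lintegral_indicator_one (by measurability), lintegral_expMeasure (by measurability)]
  rw [setLIntegral_congr_fun measurableSet_Ioi (g := fun _ => 0), lintegral_zero]
  intro x hx
  have hx : 0 < x := hx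
  simp [hx]

end Noise

/-! ### Construction of the trajectory from the noise -/

section Trajectory

variable {S : Type*} [MeasurableSpace S]

/-- Starting point and noise driving a trajectory. -/
abbrev Driver (S : Type*) := S × ((ℕ → I) × (ℕ → ℝ))

/-- The driver of the trajectory after its first jump, for the one-step update map `φ`. -/
def shift (φ : S → I → S) (ω : Driver S) : Driver S :=
  (φ ω.1 (ω.2.1 0), (fun n => ω.2.1 (n + 1), fun n => ω.2.2 (n + 1)))

/-- The embedded chain. -/
def chain (φ : S → I → S) : ℕ → Driver S → S
  | 0, ω => ω.1
  | n + 1, ω => chain φ n (shift φ ω)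

/-- The normalized holding times. -/
def hold (n : ℕ) (ω : Driver S) : ℝ := ω.2.2 n

/-- The duration of a stay at `a` with normalized holding time `g`. -/
noncomputable def stay (μ : Kernel S S) (a : S) (g : ℝ) : ℝ≥0∞ :=
  ENNReal.ofReal g / totalRate μ a

/-- The jump times of the trajectory. -/
noncomputable abbrev epoch (μ : Kernel S S) (φ : S → I → S) (n : ℕ) (ω : Driver S) : ℝ≥0∞ :=
  jumpTime μ (chain φ) hold n ω

open Classical in
/-- The state of the trajectory at time `t`, with a default value after an explosion. -/
noncomputable def state [Nonempty S] (μ : Kernel S S) (φ : S → I → S) (t : ℝ≥0∞) (ω : Driver S) :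
    S :=
  if h : ∃ n, t < epoch μ φ (n + 1) ω then chain φ (Nat.find h) ω else Classical.arbitrary S

/-- The law of the driver of the trajectory started at `a`. -/
noncomputable def driverLaw (S : Type*) [MeasurableSpace S] : Kernel S (Driver S) :=
  Kernel.id ×ₖ Kernel.const S noiseLaw

instance : IsMarkovKernel (driverLaw S) := by unfold driverLaw; infer_instance

lemma driverLaw_apply (a : S) : driverLaw S a = noiseLaw.map (Prod.mk a) := by
  rw [driverLaw, Kernel.prod_apply, Kernel.id_apply, Kernel.const_apply, Measure.dirac_prod]

lemma lintegral_driverLaw {F : Driver S → ℝ≥0∞} (hF : Measurable F) (a : S) :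
    ∫⁻ ω, F ω ∂(driverLaw S a) = ∫⁻ q, F (a, q) ∂noiseLaw := by
  rw [driverLaw_apply, lintegral_map hF measurable_prodMk_left]

variable {φ : S → I → S} {μ : Kernel S S}

lemma measurable_shift (hφ : Measurable (Function.uncurry φ)) : Measurable (shift φ) := by
  unfold shift
  refine Measurable.prodMk ?_ (by fun_prop)
  exact hφ.comp (f := fun ω : Driver S => (ω.1, ω.2.1 0)) (by fun_prop)

lemma measurable_chain (hφ : Measurable (Function.uncurry φ)) (n : ℕ) :
    Measurable (chain φ n) := by
  induction n with
  | zero => exact measurable_fst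
  | succ n ih => exact ih.comp (measurable_shift hφ)

lemma measurable_hold (n : ℕ) : Measurable (hold (S := S) n) := by
  unfold hold; fun_prop

lemma measurable_stay (μ : Kernel S S) : Measurable (Function.uncurry (stay μ)) := by
  unfold stay Function.uncurry
  exact (by fun_prop : Measurable fun p : S × ℝ => ENNReal.ofReal p.2).div
    ((measurable_totalRate μ).comp measurable_fst)

lemma measurable_epoch (hφ : Measurable (Function.uncurry φ)) (n : ℕ) :
    Measurable (epoch μ φ n) := by
  unfold epoch jumpTime
  refine Finset.measurable_fun_sum _ fun k _ => ?_
  exact (measurable_hold k).ennreal_ofReal.div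
    ((measurable_totalRate μ).comp (measurable_chain hφ k))

lemma monotone_epoch (ω : Driver S) : Monotone fun n => epoch μ φ n ω := fun _ _ h =>
  Finset.sum_le_sum_of_subset (Finset.range_subset_range.2 h)

lemma epoch_zero (ω : Driver S) : epoch μ φ 0 ω = 0 := by simp [epoch, jumpTime]

lemma epoch_succ (n : ℕ) (ω : Driver S) :
    epoch μ φ (n + 1) ω = stay μ ω.1 (ω.2.2 0) + epoch μ φ n (shift φ ω) := by
  unfold epoch jumpTime
  rw [Finset.sum_range_succ', add_comm]
  rfl

lemma epoch_one (ω : Driver S) : epoch μ φ 1 ω = stay μ ω.1 (ω.2.2 0) := by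
  rw [epoch_succ, epoch_zero, add_zero]

lemma le_epoch_succ_iff {t : ℝ≥0∞} {ω : Driver S} (ht : t ≠ ∞)
    (h : stay μ ω.1 (ω.2.2 0) ≤ t) (n : ℕ) :
    epoch μ φ (n + 1) ω ≤ t ↔ epoch μ φ n (shift φ ω) ≤ t - stay μ ω.1 (ω.2.2 0) := by
  rw [epoch_succ, (ENNReal.cancel_of_ne (ne_top_of_le_ne_top ht h)).le_tsub_iff_left h]

lemma exists_epoch_le_lt {t : ℝ≥0∞} {ω : Driver S} (h : ∃ n, t < epoch μ φ (n + 1) ω) :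
    ∃ n, epoch μ φ n ω ≤ t ∧ t < epoch μ φ (n + 1) ω := by
  classical
  refine ⟨Nat.find h, ?_, Nat.find_spec h⟩
  rcases hn : Nat.find h with _ | m
  · rw [epoch_zero]; exact zero_le
  · exact not_lt.1 (Nat.find_min h (by omega : m < Nat.find h))

section State

variable [Nonempty S]

lemma state_eq_chain {t : ℝ≥0∞} {ω : Driver S} {n : ℕ} (h1 : epoch μ φ n ω ≤ t)
    (h2 : t < epoch μ φ (n + 1) ω) : state μ φ t ω = chain φ n ω := by
  classical
  have h : ∃ n, t < epoch μ φ (n + 1) ω := ⟨n, h2⟩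
  have : Nat.find h = n := by
    refine (Nat.find_eq_iff h).2 ⟨h2, fun m hm => not_lt.2 (le_trans ?_ h1)⟩
    exact monotone_epoch ω hm
  rw [state, dif_pos h]
  convert rfl
  exact this.symm

lemma state_of_lt_stay {t : ℝ≥0∞} {ω : Driver S} (h : t < stay μ ω.1 (ω.2.2 0)) :
    state μ φ t ω = ω.1 :=
  state_eq_chain (n := 0) (by rw [epoch_zero]; exact zero_le) (by rwa [zero_add, epoch_one])

/-- Pathwise renewal: once the first stay is over, the trajectory is that of the shifted driver with
the clock set back. After an explosion both sides take the same default value, so non-explosion need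
not be assumed. -/
lemma state_of_stay_le {t : ℝ≥0∞} {ω : Driver S} (ht : t ≠ ∞) (h : stay μ ω.1 (ω.2.2 0) ≤ t) :
    state μ φ t ω = state μ φ (t - stay μ ω.1 (ω.2.2 0)) (shift φ ω) := by
  by_cases hex : ∃ n, t < epoch μ φ (n + 1) ω
  · obtain ⟨n, h1, h2⟩ := exists_epoch_le_lt hex
    cases n with
    | zero => rw [zero_add, epoch_one] at h2; exact absurd h (not_le.2 h2)
    | succ n =>
      rw [state_eq_chain h1 h2, state_eq_chain (n := n) ((le_epoch_succ_iff ht h n).1 h1)]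
      · rfl
      · rw [← not_le, ← le_epoch_succ_iff ht h]; exact not_le.2 h2
  · have hex' : ¬ ∃ n, t - stay μ ω.1 (ω.2.2 0) < epoch μ φ (n + 1) (shift φ ω) := by
      rintro ⟨n, hn⟩
      refine hex ⟨n + 1, ?_⟩
      rwa [← not_le, le_epoch_succ_iff ht h, not_le]
    rw [state, state, dif_neg hex, dif_neg hex']

/-- Joint measurability is needed because renewal evaluates the state at a random remaining time.
The sets `A n` separate the numbers of completed jumps; off their union the default value applies.
-/
lemma measurable_state (hφ : Measurable (Function.uncurry φ)) :
    Measurable fun p : ℝ≥0∞ × Driver S => state μ φ p.1 p.2 := by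
  intro B hB
  let A : ℕ → Set (ℝ≥0∞ × Driver S) := fun n =>
    {p | epoch μ φ n p.2 ≤ p.1} ∩ {p | p.1 < epoch μ φ (n + 1) p.2}
  have hep : ∀ n, Measurable fun p : ℝ≥0∞ × Driver S => epoch μ φ n p.2 := fun n =>
    (measurable_epoch hφ n).comp measurable_snd
  have hA : ∀ n, MeasurableSet (A n) := fun n =>
    (measurableSet_le (hep n) measurable_fst).inter (measurableSet_lt measurable_fst (hep _))
  have hB' : ∀ n, MeasurableSet {p : ℝ≥0∞ × Driver S | chain φ n p.2 ∈ B} := fun n =>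
    ((measurable_chain hφ n).comp measurable_snd) hB
  have : (fun p : ℝ≥0∞ × Driver S => state μ φ p.1 p.2) ⁻¹' B =
      (⋃ n, A n ∩ {p | chain φ n p.2 ∈ B}) ∪
        ((⋃ n, A n)ᶜ ∩ {_p | Classical.arbitrary S ∈ B}) := by
    ext p
    by_cases hp : p ∈ ⋃ n, A n
    · obtain ⟨n, hn⟩ := Set.mem_iUnion.1 hp
      have hst : state μ φ p.1 p.2 = chain φ n p.2 := state_eq_chain hn.1 hn.2
      constructor
      · intro h
        refine Or.inl (Set.mem_iUnion.2 ⟨n, hn, ?_⟩)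
        change state μ φ p.1 p.2 ∈ B at h
        rw [hst] at h
        exact h
      · rintro (h | h)
        · obtain ⟨m, hm, hmB⟩ := Set.mem_iUnion.1 h
          change state μ φ p.1 p.2 ∈ B
          rw [state_eq_chain hm.1 hm.2]
          exact hmB
        · exact absurd hp h.1
    · have hst : state μ φ p.1 p.2 = Classical.arbitrary S := by
        rw [state, dif_neg]
        intro hex
        obtain ⟨n, hn⟩ := exists_epoch_le_lt hex
        exact hp (Set.mem_iUnion.2 ⟨n, hn⟩)
      constructor
      · intro h
        refine Or.inr ⟨hp, ?_⟩
        change state μ φ p.1 p.2 ∈ B at h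
        rw [hst] at h
        exact h
      · rintro (h | h)
        · obtain ⟨m, hm, hmB⟩ := Set.mem_iUnion.1 h
          exact absurd (Set.mem_iUnion.2 ⟨m, hm⟩) hp
        · change state μ φ p.1 p.2 ∈ B
          rw [hst]
          exact h.2
  rw [this]
  exact (MeasurableSet.iUnion fun n => (hA n).inter (hB' n)).union
    ((MeasurableSet.iUnion hA).compl.inter (MeasurableSet.const _))

end State

/-- Decomposition of a trajectory at its first jump. -/
lemma lintegral_driverLaw_shift (hφ : Measurable (Function.uncurry φ)) {κ : Kernel S S}
    (hκ : ∀ a, (volume : Measure I).map (φ a) = κ a) (a : S) {F : ℝ × Driver S → ℝ≥0∞}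
    (hF : Measurable F) :
    ∫⁻ ω, F (ω.2.2 0, shift φ ω) ∂(driverLaw S a) =
      ∫⁻ g, ∫⁻ b, ∫⁻ ω, F (g, ω) ∂(driverLaw S b) ∂(κ a) ∂(expMeasure 1) := by
  have hφa : Measurable (φ a) := hφ.comp measurable_prodMk_left
  have hF' : Measurable fun p : (I × ℝ) × ((ℕ → I) × (ℕ → ℝ)) =>
      F (p.1.2, (φ a p.1.1, p.2)) := by fun_prop
  have hm : Measurable fun ω : Driver S => F (ω.2.2 0, shift φ ω) :=
    hF.comp (Measurable.prodMk (by fun_prop) (measurable_shift hφ))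
  refine (lintegral_driverLaw hm a).trans ((lintegral_noiseLaw hF').trans ?_)
  refine lintegral_congr fun g => ?_
  have hFg : Measurable fun ω => F (g, ω) := hF.comp measurable_prodMk_left
  rw [← hκ a, lintegral_map hFg.lintegral_kernel hφa]
  exact lintegral_congr fun u => (lintegral_driverLaw hFg (φ a u)).symm

lemma ae_fst_eq [MeasurableSingletonClass S] (a : S) : ∀ᵐ ω ∂(driverLaw S a), ω.1 = a := by
  have h : MeasurableSet {ω : Driver S | ω.1 = a} :=
    measurable_fst (measurableSet_singleton a)
  rw [driverLaw_apply, ae_map_iff measurable_prodMk_left.aemeasurable h]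
  exact Eventually.of_forall fun _ => rfl

end Trajectory

/-! ### Memorylessness of the holding times -/

section Memoryless

/-- `exp(-x) = exp(-c) exp(-(x - c))`, combined with translation invariance of Lebesgue measure. -/
lemma lintegral_expMeasure_shift {c : ℝ} (hc : 0 ≤ c) {H : ℝ → ℝ≥0∞} (hH : Measurable H) :
    ∫⁻ g, (Set.Ioi c).indicator (fun g => H (g - c)) g ∂(expMeasure 1) =
      ENNReal.ofReal (Real.exp (-c)) * ∫⁻ g, H g ∂(expMeasure 1) := by
  have hm : Measurable ((Set.Ioi c).indicator (fun g => H (g - c))) :=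
    (hH.comp (measurable_id.sub_const c)).indicator measurableSet_Ioi
  rw [lintegral_expMeasure hm, lintegral_expMeasure hH, ← lintegral_const_mul _ (by fun_prop),
    ← lintegral_indicator measurableSet_Ioi, ← lintegral_indicator measurableSet_Ioi]
  conv_rhs => rw [← lintegral_sub_right_eq_self _ c]
  refine lintegral_congr fun x => ?_
  by_cases hx : c < x
  · have h0 : 0 < x := hc.trans_lt hx
    have h1 : 0 < x - c := sub_pos.2 hx
    simp only [Set.indicator, Set.mem_Ioi, hx, h0, h1, if_true]
    rw [← mul_assoc, ← ENNReal.ofReal_mul (Real.exp_nonneg _), ← Real.exp_add]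
    congr 3
    ring
  · have h1 : ¬ 0 < x - c := fun h => hx (sub_pos.1 h)
    simp [Set.indicator, hx, h1]

lemma expMeasure_Ioi {c : ℝ} (hc : 0 ≤ c) :
    expMeasure 1 (Set.Ioi c) = ENNReal.ofReal (Real.exp (-c)) := by
  have := lintegral_expMeasure_shift hc (H := fun _ => 1) measurable_const
  simp only [lintegral_const, measure_univ, mul_one] at this
  rw [← this, lintegral_indicator measurableSet_Ioi]
  simp

variable {S : Type*} [MeasurableSpace S] {μ : Kernel S S}

/-- Positivity of `g` matters, since `0 / 0 = 0` in `ℝ≥0∞`. -/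
lemma stay_of_rate_eq_zero {a : S} (h : totalRate μ a = 0) {g : ℝ} (hg : 0 < g) :
    stay μ a g = ∞ := by
  rw [stay, h, ENNReal.div_zero]
  exact (ENNReal.ofReal_pos.2 hg).ne'

lemma stay_of_rate_ne_zero (hr : IsRateKernel μ) {a : S} (h : totalRate μ a ≠ 0) (g : ℝ) :
    stay μ a g = ENNReal.ofReal (g / (totalRate μ a).toReal) := by
  have hpos : 0 < (totalRate μ a).toReal := ENNReal.toReal_pos h (hr a).ne
  rw [stay, ENNReal.ofReal_div_of_pos hpos, ENNReal.ofReal_toReal (hr a).ne]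

lemma measurable_stay_right (a : S) : Measurable (stay μ a) :=
  (measurable_stay μ).comp measurable_prodMk_left

/-- Given a stay longer than `s`, the remainder is distributed as a fresh stay. At an absorbing
point this reads `∞ - s = ∞`; elsewhere it is the previous shift by `s · λ(a)`. -/
lemma stay_memoryless (hr : IsRateKernel μ) (a : S) {s : ℝ≥0∞} (hs : s ≠ ∞)
    {F : ℝ≥0∞ → ℝ≥0∞} (hF : Measurable F) :
    ∫⁻ g in {g | s < stay μ a g}, F (stay μ a g - s) ∂(expMeasure 1) =
      expMeasure 1 {g | s < stay μ a g} * ∫⁻ g, F (stay μ a g) ∂(expMeasure 1) := by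
  by_cases h : totalRate μ a = 0
  · have hst : ∀ᵐ g ∂(expMeasure 1), stay μ a g = ∞ := by
      filter_upwards [ae_pos_expMeasure] with g hg using stay_of_rate_eq_zero h hg
    have huniv : {g | s < stay μ a g} =ᵐ[expMeasure 1] Set.univ := by
      rw [eventuallyEq_univ]
      filter_upwards [hst] with g hg
      rw [hg]
      exact hs.lt_top
    rw [setLIntegral_congr huniv, measure_congr huniv, setLIntegral_univ, measure_univ, one_mul]
    refine lintegral_congr_ae ?_
    filter_upwards [hst] with g hg
    rw [hg, ENNReal.top_sub hs]
  · have hpos : 0 < (totalRate μ a).toReal := ENNReal.toReal_pos h (hr a).ne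
    set l := (totalRate μ a).toReal with hl
    have hst := stay_of_rate_ne_zero hr h
    have hc : 0 ≤ s.toReal * l := by positivity
    have hset : {g | s < stay μ a g} = Set.Ioi (s.toReal * l) := by
      ext g
      change s < stay μ a g ↔ s.toReal * l < g
      rw [hst, ENNReal.lt_ofReal_iff_toReal_lt hs, lt_div_iff₀ hpos]
    have hsub : ∀ g, stay μ a g - s = stay μ a (g - s.toReal * l) := fun g => by
      rw [hst, hst, sub_div, mul_div_cancel_right₀ _ hpos.ne',
        ENNReal.ofReal_sub _ ENNReal.toReal_nonneg, ENNReal.ofReal_toReal hs]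
    simp only [hset, hsub, expMeasure_Ioi hc]
    rw [← lintegral_indicator measurableSet_Ioi]
    exact lintegral_expMeasure_shift hc (hF.comp (measurable_stay_right a))

end Memoryless

/-! ### Conditional probabilities via set integrals -/

section CondExp

/-- Lets both Markov properties be proved as identities of `ℝ≥0∞`-valued set integrals, with no
integrability to check. -/
lemma condExp_indicator_ae_eq {Ω : Type*} {m m₀ : MeasurableSpace Ω} (hm : m ≤ m₀)
    {Q : Measure Ω} [IsProbabilityMeasure Q] {E : Set Ω} (hE : MeasurableSet E)
    {p : Ω → ℝ≥0∞} (hp : Measurable[m] p) (hp1 : ∀ ω, p ω ≤ 1)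
    (h : ∀ A, MeasurableSet[m] A → ∫⁻ ω in A, E.indicator 1 ω ∂Q = ∫⁻ ω in A, p ω ∂Q) :
    Q⟦E | m⟧ =ᵐ[Q] fun ω => (p ω).toReal := by
  have hpm : Measurable p := hp.mono hm le_rfl
  have hpi : Integrable (fun ω => (p ω).toReal) Q := by
    refine Integrable.of_bound hpm.ennreal_toReal.aestronglyMeasurable 1
      (Eventually.of_forall fun ω => ?_)
    rw [Real.norm_of_nonneg ENNReal.toReal_nonneg]
    exact ENNReal.toReal_le_of_le_ofReal zero_le_one (by simpa using hp1 ω)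
  refine (ae_eq_condExp_of_forall_setIntegral_eq hm
    ((integrable_const (1 : ℝ)).indicator hE) (fun _ _ _ => hpi.integrableOn) ?_ ?_).symm
  · intro A hA _
    have h1 : ∫ ω in A, (p ω).toReal ∂Q = (∫⁻ ω in A, p ω ∂Q).toReal :=
      integral_toReal hpm.aemeasurable
        (Eventually.of_forall fun ω => (hp1 ω).trans_lt ENNReal.one_lt_top)
    rw [h1, ← h A hA, integral_indicator hE, lintegral_indicator hE]
    simp [Measure.real]
  · exact hp.ennreal_toReal.aestronglyMeasurable

end CondExp

/-! ### Markov property of the embedded chain -/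

section Markov

variable {S : Type*} [MeasurableSpace S] {φ : S → I → S} {μ : Kernel S S}

section Chain

/-- The embedded chain stopped at time `n`. -/
def chainHist (φ : S → I → S) (n : ℕ) (ω : Driver S) : ℕ → S := fun k => chain φ (min k n) ω

lemma measurable_chainHist (hφ : Measurable (Function.uncurry φ)) (n : ℕ) :
    Measurable (chainHist φ n) :=
  measurable_pi_lambda _ fun _ => measurable_chain hφ _

/-- Prepend a state to a path of the chain. -/
def consPath (a : S) (p : ℕ → S) : ℕ → S := fun k => Nat.casesOn k a p

lemma measurable_consPath (a : S) : Measurable (consPath a) := by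
  refine measurable_pi_lambda _ fun k => ?_
  cases k with
  | zero => exact measurable_const
  | succ k => exact measurable_pi_apply k

lemma chainHist_succ {S : Type*} {φ : S → I → S} (n : ℕ) (ω : Driver S) :
    chainHist φ (n + 1) ω = consPath ω.1 (chainHist φ n (shift φ ω)) := by
  funext k
  cases k with
  | zero => rw [chainHist, Nat.zero_min]; rfl
  | succ k => rw [chainHist, Nat.succ_min_succ]; rfl

/-- Every past event becomes a condition `W` on a single path-valued map, a form in which one can
induct over `W`. -/
lemma pastSigma_chain_le (n : ℕ) :
    pastSigma (chain φ) n ≤ MeasurableSpace.comap (chainHist φ n) inferInstance := by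
  refine iSup₂_le fun k hk => ?_
  have : chain φ k = (fun p : ℕ → S => p k) ∘ chainHist φ n := by
    funext ω
    simp [chainHist, min_eq_left hk]
  rw [this, ← MeasurableSpace.comap_comp]
  exact MeasurableSpace.comap_mono (measurable_pi_apply k).comap_le

lemma setLIntegral_chain_step [MeasurableSingletonClass S]
    (hφ : Measurable (Function.uncurry φ)) {κ : Kernel S S}
    (hκ : ∀ a, (volume : Measure I).map (φ a) = κ a)
    {W : Set (ℕ → S)} (hW : MeasurableSet W) {K : Driver S → ℝ≥0∞} (hK : Measurable K)
    (n : ℕ) (a : S) :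
    ∫⁻ ω in chainHist φ (n + 1) ⁻¹' W, K (shift φ ω) ∂(driverLaw S a) =
      ∫⁻ b, ∫⁻ ω in chainHist φ n ⁻¹' (consPath a ⁻¹' W), K ω ∂(driverLaw S b) ∂(κ a) := by
  have hA := measurable_chainHist hφ n (measurable_consPath a hW)
  have hF : Measurable fun p : ℝ × Driver S =>
      (chainHist φ n ⁻¹' (consPath a ⁻¹' W)).indicator K p.2 :=
    (hK.indicator hA).comp measurable_snd
  rw [← lintegral_indicator (measurable_chainHist hφ _ hW)]
  trans ∫⁻ ω, (chainHist φ n ⁻¹' (consPath a ⁻¹' W)).indicator K (shift φ ω) ∂(driverLaw S a)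
  · refine lintegral_congr_ae ?_
    filter_upwards [ae_fst_eq a] with ω hω
    have e : ω ∈ chainHist φ (n + 1) ⁻¹' W ↔
        shift φ ω ∈ chainHist φ n ⁻¹' (consPath a ⁻¹' W) := by
      rw [Set.mem_preimage, chainHist_succ, hω]
      rfl
    by_cases hm : shift φ ω ∈ chainHist φ n ⁻¹' (consPath a ⁻¹' W)
    · rw [Set.indicator_of_mem (e.2 hm), Set.indicator_of_mem hm]
    · rw [Set.indicator_of_notMem (fun h => hm (e.1 h)), Set.indicator_of_notMem hm]
  · rw [lintegral_driverLaw_shift hφ hκ a hF]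
    simp only [lintegral_indicator hA, lintegral_const, measure_univ, mul_one]

/-- The induction needs all `W` and all `a` at once: removing the first step moves the starting
point and replaces `W` by its preimage under prepending. For `n = 0` the history is the constant
path `a`, so `W` is almost surely trivial. -/
lemma chain_markov_aux [MeasurableSingletonClass S] (hφ : Measurable (Function.uncurry φ))
    {κ : Kernel S S} (hκ : ∀ a, (volume : Measure I).map (φ a) = κ a)
    {B : Set S} (hB : MeasurableSet B) (n : ℕ) :
    ∀ (W : Set (ℕ → S)), MeasurableSet W → ∀ a : S,
    ∫⁻ ω in chainHist φ n ⁻¹' W, B.indicator 1 (chain φ (n + 1) ω) ∂(driverLaw S a) =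
      ∫⁻ ω in chainHist φ n ⁻¹' W, κ (chain φ n ω) B ∂(driverLaw S a) := by
  have hBm : Measurable (B.indicator (1 : S → ℝ≥0∞)) := measurable_one.indicator hB
  induction n with
  | zero =>
    intro W hW a
    have hF : Measurable fun p : ℝ × Driver S => B.indicator (1 : S → ℝ≥0∞) p.2.1 := by fun_prop
    have h1 : ∫⁻ ω, B.indicator 1 (chain φ 1 ω) ∂(driverLaw S a) = κ a B := by
      refine (lintegral_driverLaw_shift hφ hκ a hF).trans ?_
      have : ∀ b : S, ∫⁻ ω, B.indicator (1 : S → ℝ≥0∞) ω.1 ∂(driverLaw S b) = B.indicator 1 b :=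
        fun b => by
          rw [lintegral_driverLaw (by fun_prop)]
          simp
      have hprob : IsProbabilityMeasure (expMeasure 1) := inferInstance
      simp only [this, lintegral_const, measure_univ, mul_one, lintegral_indicator_one hB]
    have h2 : ∫⁻ ω, κ (chain φ 0 ω) B ∂(driverLaw S a) = κ a B := by
      rw [lintegral_congr_ae (g := fun _ => κ a B)]
      · simp
      · filter_upwards [ae_fst_eq a] with ω hω
        rw [chain, hω]
    have h3 : ∀ᵐ ω ∂(driverLaw S a), (ω ∈ chainHist φ 0 ⁻¹' W ↔ (fun _ => a) ∈ W) := by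
      filter_upwards [ae_fst_eq a] with ω hω
      have : chainHist φ 0 ω = fun _ => a := by
        funext k
        rw [chainHist, Nat.min_zero, chain, hω]
      rw [Set.mem_preimage, this]
    by_cases h : (fun _ => a) ∈ W
    · have h4 : chainHist φ 0 ⁻¹' W =ᵐ[driverLaw S a] Set.univ := by
        rw [eventuallyEq_univ]
        filter_upwards [h3] with ω hω using hω.2 h
      rw [setLIntegral_congr h4, setLIntegral_congr h4, setLIntegral_univ, setLIntegral_univ,
        h1, h2]
    · have h4 : driverLaw S a (chainHist φ 0 ⁻¹' W) = 0 := by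
        rw [measure_eq_zero_iff_ae_notMem]
        filter_upwards [h3] with ω hω using fun hm => h (hω.1 hm)
      rw [setLIntegral_measure_zero _ _ h4, setLIntegral_measure_zero _ _ h4]
  | succ n ih =>
    intro W hW a
    have e1 := setLIntegral_chain_step hφ hκ hW
      (K := fun ω => B.indicator 1 (chain φ (n + 1) ω)) (hBm.comp (measurable_chain hφ _)) n a
    have e2 := setLIntegral_chain_step hφ hκ hW
      (K := fun ω => κ (chain φ n ω) B)
      ((κ.measurable_coe hB).comp (measurable_chain hφ _)) n a
    refine e1.trans (Eq.trans ?_ e2.symm)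
    exact lintegral_congr fun b => ih _ (measurable_consPath a hW) b

lemma isMarkovChainFrom_chain [MeasurableSingletonClass S] (hφ : Measurable (Function.uncurry φ))
    {κ : Kernel S S} [IsMarkovKernel κ] (hκ : ∀ a, (volume : Measure I).map (φ a) = κ a) (a : S) :
    IsMarkovChainFrom κ a (driverLaw S a) (chain φ) where
  measurable := measurable_chain hφ
  start := ae_fst_eq a
  step n B hB := by
    have hle : pastSigma (chain φ) n ≤ (inferInstance : MeasurableSpace (Driver S)) :=
      iSup₂_le fun k _ => (measurable_chain hφ k).comap_le
    refine condExp_indicator_ae_eq hle (measurable_chain hφ _ hB) (p := fun ω => κ (chain φ n ω) B)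
      ?_ (fun ω => prob_le_one) fun A hA => ?_
    · refine (κ.measurable_coe hB).comp (Measurable.of_comap_le ?_)
      exact le_iSup₂_of_le n le_rfl le_rfl
    · obtain ⟨W, hW, rfl⟩ := pastSigma_chain_le n A hA
      exact chain_markov_aux hφ hκ hB n W hW a

end Chain

end Markov

/-! ### Markov property in continuous time -/

section StateMarkov

variable {S : Type*} [MeasurableSpace S] [Nonempty S] {φ : S → I → S} {μ : Kernel S S}

/-- The trajectory stopped at time `s`. -/
noncomputable def hist (μ : Kernel S S) (φ : S → I → S) (s : ℝ≥0∞) (ω : Driver S) : ℝ≥0∞ → S :=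
  fun u => state μ φ (min u s) ω

lemma measurable_state_right (hφ : Measurable (Function.uncurry φ)) (t : ℝ≥0∞) :
    Measurable (state μ φ t) := by
  have h := (measurable_state (μ := μ) hφ).comp (measurable_prodMk_left (x := t))
  exact h

lemma measurable_state_comp {β : Type*} [MeasurableSpace β] (hφ : Measurable (Function.uncurry φ))
    {f : β → ℝ≥0∞} {g : β → Driver S} (hf : Measurable f) (hg : Measurable g) :
    Measurable fun x => state μ φ (f x) (g x) := by
  have h := (measurable_state (μ := μ) hφ).comp (hf.prodMk hg)
  exact h

lemma measurable_hist (hφ : Measurable (Function.uncurry φ)) (s : ℝ≥0∞) :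
    Measurable (hist μ φ s) :=
  measurable_pi_lambda _ fun _ => measurable_state_right hφ _

lemma pastSigma_state_le (s : ℝ≥0) :
    pastSigma (fun t : ℝ≥0 => state μ φ (t : ℝ≥0∞)) s ≤
      MeasurableSpace.comap (hist μ φ s) inferInstance := by
  refine iSup₂_le fun u hu => ?_
  have : state μ φ (u : ℝ≥0∞) = (fun p : ℝ≥0∞ → S => p u) ∘ hist μ φ s := by
    funext ω
    simp [hist, min_eq_left (ENNReal.coe_le_coe.2 hu)]
  change MeasurableSpace.comap (state μ φ (u : ℝ≥0∞)) inferInstance ≤ _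
  rw [this, ← MeasurableSpace.comap_comp]
  exact MeasurableSpace.comap_mono (measurable_pi_apply _).comap_le

open Classical in
/-- Delay by `d` a path stopped at time `s - d`, with the value `a` until time `d`. -/
noncomputable def delay (a : S) (s d : ℝ≥0∞) (p : ℝ≥0∞ → S) : ℝ≥0∞ → S :=
  fun u => if min u s < d then a else p (u - d)

lemma measurable_delay {S : Type*} [MeasurableSpace S] (a : S) (s d : ℝ≥0∞) : Measurable (delay a s d) := by
  refine measurable_pi_lambda _ fun u => ?_
  unfold delay
  split_ifs
  · exact measurable_const
  · exact measurable_pi_apply _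

lemma hist_eq_delay {s : ℝ≥0∞} (hs : s ≠ ∞) (ω : Driver S) :
    hist μ φ s ω = delay ω.1 s (stay μ ω.1 (ω.2.2 0))
      (hist μ φ (s - stay μ ω.1 (ω.2.2 0)) (shift φ ω)) := by
  funext u
  unfold hist delay
  split_ifs with h
  · exact state_of_lt_stay h
  · have hmono : Monotone fun x : ℝ≥0∞ => x - stay μ ω.1 (ω.2.2 0) :=
      fun _ _ hxy => tsub_le_tsub_right hxy _
    rw [state_of_stay_le (ne_top_of_le_ne_top hs (min_le_right u s)) (not_lt.1 h)]
    exact congrArg (fun r => state μ φ r (shift φ ω)) hmono.map_min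

/-- Before time `s` there are exactly `n` jumps, and the trajectory stopped at `s` is in `W`. -/
def window (μ : Kernel S S) (φ : S → I → S) (n : ℕ) (s : ℝ≥0∞) (W : Set (ℝ≥0∞ → S)) :
    Set (Driver S) :=
  {ω | (epoch μ φ n ω ≤ s ∧ s < epoch μ φ (n + 1) ω) ∧ hist μ φ s ω ∈ W}

lemma measurableSet_window (hφ : Measurable (Function.uncurry φ)) (n : ℕ) (s : ℝ≥0∞)
    {W : Set (ℝ≥0∞ → S)} (hW : MeasurableSet W) : MeasurableSet (window μ φ n s W) :=
  ((measurableSet_le (measurable_epoch hφ n) measurable_const).inter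
    (measurableSet_lt measurable_const (measurable_epoch hφ _))).inter (measurable_hist hφ s hW)

lemma mem_window_succ_iff {s : ℝ≥0∞} (hs : s ≠ ∞) (n : ℕ) (W : Set (ℝ≥0∞ → S)) (ω : Driver S) :
    ω ∈ window μ φ (n + 1) s W ↔ stay μ ω.1 (ω.2.2 0) ≤ s ∧
      shift φ ω ∈ window μ φ n (s - stay μ ω.1 (ω.2.2 0))
        (delay ω.1 s (stay μ ω.1 (ω.2.2 0)) ⁻¹' W) := by
  by_cases h : stay μ ω.1 (ω.2.2 0) ≤ s
  · simp only [window, Set.mem_ofPred_eq, h, true_and, Set.mem_preimage, ← hist_eq_delay hs,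
      ← le_epoch_succ_iff hs h, ← not_le]
  · refine iff_of_false (fun hω => h (le_trans ?_ hω.1.1)) fun hω => h hω.1
    rw [epoch_succ]
    exact le_self_add

open Classical in
-- The integrand `K` carries the remaining time as an argument, so one statement covers both sides
-- of the Markov identity: the indicator at time `s + t` and the transition probability from the
-- state at `s`.
lemma setLIntegral_window_succ [MeasurableSingletonClass S]
    (hφ : Measurable (Function.uncurry φ)) {κ : Kernel S S}
    (hκ : ∀ a, (volume : Measure I).map (φ a) = κ a) {s : ℝ≥0∞} (hs : s ≠ ∞)
    {W : Set (ℝ≥0∞ → S)} (hW : MeasurableSet W) {K : ℝ≥0∞ → Driver S → ℝ≥0∞}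
    (hK : Measurable (Function.uncurry K))
    (hKs : ∀ ω, stay μ ω.1 (ω.2.2 0) ≤ s →
      K s ω = K (s - stay μ ω.1 (ω.2.2 0)) (shift φ ω)) (n : ℕ) (a : S) :
    ∫⁻ ω in window μ φ (n + 1) s W, K s ω ∂(driverLaw S a) =
      ∫⁻ g, ∫⁻ b, (if stay μ a g ≤ s then
        ∫⁻ ω in window μ φ n (s - stay μ a g) (delay a s (stay μ a g) ⁻¹' W),
          K (s - stay μ a g) ω ∂(driverLaw S b) else 0) ∂(κ a) ∂(expMeasure 1) := by
  let J : Set (ℝ × Driver S) := {p | stay μ a p.1 ≤ s ∧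
    p.2 ∈ window μ φ n (s - stay μ a p.1) (delay a s (stay μ a p.1) ⁻¹' W)}
  have hst : Measurable fun p : ℝ × Driver S => stay μ a p.1 :=
    (measurable_stay_right a).comp measurable_fst
  have hsub : Measurable fun p : ℝ × Driver S => s - stay μ a p.1 := measurable_const.sub hst
  have hep : ∀ n, Measurable fun p : ℝ × Driver S => epoch μ φ n p.2 := fun n =>
    (measurable_epoch hφ n).comp measurable_snd
  have hpath : Measurable fun p : ℝ × Driver S =>
      delay a s (stay μ a p.1) (hist μ φ (s - stay μ a p.1) p.2) := by
    refine measurable_pi_lambda _ fun u => ?_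
    refine Measurable.ite (measurableSet_lt measurable_const hst) measurable_const ?_
    exact measurable_state_comp hφ ((measurable_const.sub hst).min hsub) measurable_snd
  have hJ : MeasurableSet J :=
    (measurableSet_le hst measurable_const).inter
      (((measurableSet_le (hep n) hsub).inter (measurableSet_lt hsub (hep (n + 1)))).inter
        (hpath hW))
  have hF : Measurable (J.indicator fun p => K (s - stay μ a p.1) p.2) :=
    (hK.comp (hsub.prodMk measurable_snd)).indicator hJ
  rw [← lintegral_indicator (measurableSet_window hφ _ s hW)]
  trans ∫⁻ ω, J.indicator (fun p => K (s - stay μ a p.1) p.2) (ω.2.2 0, shift φ ω) ∂(driverLaw S a)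
  · refine lintegral_congr_ae ?_
    filter_upwards [ae_fst_eq a] with ω hω
    have e : ω ∈ window μ φ (n + 1) s W ↔ (ω.2.2 0, shift φ ω) ∈ J := by
      rw [mem_window_succ_iff hs, hω]
      rfl
    by_cases hm : (ω.2.2 0, shift φ ω) ∈ J
    · rw [Set.indicator_of_mem (e.2 hm), Set.indicator_of_mem hm, hKs _ (hω ▸ hm.1), hω]
    · rw [Set.indicator_of_notMem (fun h => hm (e.1 h)), Set.indicator_of_notMem hm]
  · rw [lintegral_driverLaw_shift hφ hκ a hF]
    refine lintegral_congr fun g => lintegral_congr fun b => ?_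
    split_ifs with h
    · rw [← lintegral_indicator (measurableSet_window hφ _ _ (measurable_delay a s _ hW))]
      refine lintegral_congr fun ω => ?_
      have e : (g, ω) ∈ J ↔
          ω ∈ window μ φ n (s - stay μ a g) (delay a s (stay μ a g) ⁻¹' W) :=
        and_iff_right h
      by_cases hm : (g, ω) ∈ J
      · rw [Set.indicator_of_mem (e.1 hm), Set.indicator_of_mem hm]
      · rw [Set.indicator_of_notMem (fun h => hm (e.2 h)), Set.indicator_of_notMem hm]
    · rw [lintegral_congr (g := fun _ => 0), lintegral_zero]
      exact fun ω => Set.indicator_of_notMem (fun hm => h hm.1) _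

/-- The transition probabilities of the trajectory. -/
noncomputable def transProb (μ : Kernel S S) (φ : S → I → S) (B : Set S) (t : ℝ≥0∞) (a : S) : ℝ≥0∞ :=
  driverLaw S a (state μ φ t ⁻¹' B)

lemma measurable_transProb_uncurry (hφ : Measurable (Function.uncurry φ)) {B : Set S}
    (hB : MeasurableSet B) : Measurable fun p : ℝ≥0∞ × S => transProb μ φ B p.1 p.2 := by
  have hBm : Measurable (B.indicator (1 : S → ℝ≥0∞)) := measurable_one.indicator hB
  have h : ∀ p : ℝ≥0∞ × S, transProb μ φ B p.1 p.2 =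
      ∫⁻ q, B.indicator 1 (state μ φ p.1 (p.2, q)) ∂noiseLaw := fun p => by
    rw [transProb, ← lintegral_indicator_one (measurable_state_right hφ _ hB)]
    exact lintegral_driverLaw (hBm.comp (measurable_state_right hφ _)) _
  simp_rw [h]
  have hst : Measurable fun r : (ℝ≥0∞ × S) × ((ℕ → I) × (ℕ → ℝ)) =>
      state μ φ r.1.1 (r.1.2, r.2) :=
    (measurable_state (μ := μ) hφ).comp
      (f := fun r : (ℝ≥0∞ × S) × ((ℕ → I) × (ℕ → ℝ)) => (r.1.1, (r.1.2, r.2))) (by fun_prop)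
  exact (hBm.comp hst).lintegral_prod_right'

lemma measurable_transProb_comp {β : Type*} [MeasurableSpace β]
    (hφ : Measurable (Function.uncurry φ)) {B : Set S} (hB : MeasurableSet B)
    {f : β → ℝ≥0∞} {g : β → S} (hf : Measurable f) (hg : Measurable g) :
    Measurable fun x => transProb μ φ B (f x) (g x) :=
  Measurable.comp (g := fun p : ℝ≥0∞ × S => transProb μ φ B p.1 p.2) (f := fun x => (f x, g x))
    (measurable_transProb_uncurry hφ hB) (hf.prodMk hg)

lemma measurable_transProb (hφ : Measurable (Function.uncurry φ)) {B : Set S}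
    (hB : MeasurableSet B) (t : ℝ≥0∞) : Measurable (transProb μ φ B t) :=
  measurable_transProb_comp hφ hB measurable_const measurable_id

open Classical in
/-- The conditional probability of being in `B` at time `t` given the first holding time `d`. -/
noncomputable def renewal (μ : Kernel S S) (φ : S → I → S) (κ : Kernel S S) (B : Set S) (a : S)
    (t d : ℝ≥0∞) : ℝ≥0∞ :=
  if t < d then B.indicator 1 a else ∫⁻ b, transProb μ φ B (t - d) b ∂(κ a)

lemma measurable_renewal (hφ : Measurable (Function.uncurry φ)) {κ : Kernel S S}
    [IsMarkovKernel κ] {B : Set S} (hB : MeasurableSet B) (a : S) (t : ℝ≥0∞) :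
    Measurable (renewal μ φ κ B a t) := by
  unfold renewal
  refine Measurable.ite (measurableSet_lt measurable_const measurable_id) measurable_const ?_
  refine Measurable.lintegral_prod_right'
    (f := fun p : ℝ≥0∞ × S => transProb μ φ B (t - p.1) p.2) ?_
  exact measurable_transProb_comp hφ hB (measurable_const.sub measurable_fst) measurable_snd

/-- Decomposition at the first jump of the event that the trajectory is in `B` at time `t`. -/
lemma setLIntegral_state_eq_renewal [MeasurableSingletonClass S]
    (hφ : Measurable (Function.uncurry φ)) {κ : Kernel S S} [IsMarkovKernel κ]
    (hκ : ∀ a, (volume : Measure I).map (φ a) = κ a) {B : Set S} (hB : MeasurableSet B)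
    (a : S) {t : ℝ≥0∞} (ht : t ≠ ∞) {V : Set ℝ} (hV : MeasurableSet V) :
    ∫⁻ ω in (fun ω : Driver S => ω.2.2 0) ⁻¹' V, B.indicator 1 (state μ φ t ω) ∂(driverLaw S a) =
      ∫⁻ g in V, renewal μ φ κ B a t (stay μ a g) ∂(expMeasure 1) := by
  classical
  have hBm : Measurable (B.indicator (1 : S → ℝ≥0∞)) := measurable_one.indicator hB
  -- The set `V` of holding times serves two uses: `V = univ` for the renewal equation, and `V = {g
  -- | s < stay μ a g}` for the event of no jump before `s`.
  let F : ℝ × Driver S → ℝ≥0∞ := fun p => V.indicator 1 p.1 *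
    if t < stay μ a p.1 then B.indicator 1 a else B.indicator 1 (state μ φ (t - stay μ a p.1) p.2)
  have hst : Measurable fun p : ℝ × Driver S => stay μ a p.1 :=
    (measurable_stay_right a).comp measurable_fst
  have hF : Measurable F := by
    refine ((measurable_one.indicator hV).comp measurable_fst).mul ?_
    refine Measurable.ite (measurableSet_lt measurable_const hst) measurable_const ?_
    exact hBm.comp (measurable_state_comp hφ (measurable_const.sub hst) measurable_snd)
  have hV' : MeasurableSet ((fun ω : Driver S => ω.2.2 0) ⁻¹' V) :=
    (by fun_prop : Measurable fun ω : Driver S => ω.2.2 0) hV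
  rw [← lintegral_indicator hV', ← lintegral_indicator hV]
  trans ∫⁻ ω, F (ω.2.2 0, shift φ ω) ∂(driverLaw S a)
  · refine lintegral_congr_ae ?_
    filter_upwards [ae_fst_eq a] with ω hω
    simp only [F]
    by_cases hg : ω.2.2 0 ∈ V
    · rw [Set.indicator_of_mem hg,
        Set.indicator_of_mem (show ω ∈ (fun ω : Driver S => ω.2.2 0) ⁻¹' V from hg),
        Pi.one_apply, one_mul]
      split_ifs with h
      · rw [state_of_lt_stay (by rwa [hω]), hω]
      · rw [state_of_stay_le ht (by rw [hω]; exact not_lt.1 h), hω]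
    · rw [Set.indicator_of_notMem hg,
        Set.indicator_of_notMem (show ω ∉ (fun ω : Driver S => ω.2.2 0) ⁻¹' V from hg),
        zero_mul]
  · rw [lintegral_driverLaw_shift hφ hκ a hF]
    refine lintegral_congr fun g => ?_
    simp only [F]
    by_cases hg : g ∈ V
    · rw [Set.indicator_of_mem hg]
      simp only [Set.indicator_of_mem hg, Pi.one_apply, one_mul, renewal]
      split_ifs with h
      · simp
      · refine lintegral_congr fun b => ?_
        rw [transProb, ← lintegral_indicator_one (measurable_state_right hφ _ hB)]
        rfl
    · simp [hg]

lemma transProb_eq_lintegral_renewal [MeasurableSingletonClass S]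
    (hφ : Measurable (Function.uncurry φ)) {κ : Kernel S S} [IsMarkovKernel κ]
    (hκ : ∀ a, (volume : Measure I).map (φ a) = κ a) {B : Set S} (hB : MeasurableSet B)
    (a : S) {t : ℝ≥0∞} (ht : t ≠ ∞) :
    transProb μ φ B t a = ∫⁻ g, renewal μ φ κ B a t (stay μ a g) ∂(expMeasure 1) := by
  have := setLIntegral_state_eq_renewal (μ := μ) hφ hκ hB a ht MeasurableSet.univ
  rw [Set.preimage_univ, setLIntegral_univ, setLIntegral_univ] at this
  rw [← this, transProb, ← lintegral_indicator_one (measurable_state_right hφ _ hB)]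
  rfl

/-- With no jump up to `s` the history is constantly `a`, so `W` either always or never holds there.
In the first case only the remaining stay `stay - s` matters, and it is memoryless. -/
lemma window_markov_zero [MeasurableSingletonClass S] (hr : IsRateKernel μ)
    (hφ : Measurable (Function.uncurry φ)) {κ : Kernel S S} [IsMarkovKernel κ]
    (hκ : ∀ a, (volume : Measure I).map (φ a) = κ a) {B : Set S} (hB : MeasurableSet B)
    {t : ℝ≥0∞} (ht : t ≠ ∞) {s : ℝ≥0∞} (hs : s ≠ ∞) (W : Set (ℝ≥0∞ → S)) (a : S) :
    ∫⁻ ω in window μ φ 0 s W, B.indicator 1 (state μ φ (s + t) ω) ∂(driverLaw S a) =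
      ∫⁻ ω in window μ φ 0 s W, transProb μ φ B t (state μ φ s ω) ∂(driverLaw S a) := by
  let V : Set ℝ := {g | s < stay μ a g}
  have hV : MeasurableSet V := measurableSet_lt measurable_const (measurable_stay_right a)
  have hmem : ∀ᵐ ω ∂(driverLaw S a), (ω ∈ window μ φ 0 s W ↔ ω.2.2 0 ∈ V ∧ (fun _ => a) ∈ W) := by
    filter_upwards [ae_fst_eq a] with ω hω
    have h1 : ω ∈ window μ φ 0 s W ↔ ω.2.2 0 ∈ V ∧ hist μ φ s ω ∈ W := by
      simp [window, V, epoch_zero, epoch_one, hω]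
    rw [h1]
    refine and_congr_right fun h => ?_
    have : hist μ φ s ω = fun _ => a := by
      funext u
      rw [hist, state_of_lt_stay, hω]
      rw [hω]
      exact (min_le_right u s).trans_lt h
    rw [this]
  by_cases haW : (fun _ => a) ∈ W
  · have hset : window μ φ 0 s W =ᵐ[driverLaw S a] (fun ω : Driver S => ω.2.2 0) ⁻¹' V := by
      rw [eventuallyEq_set]
      filter_upwards [hmem] with ω hω
      rw [hω, Set.mem_preimage]
      exact and_iff_left haW
    have hV' : MeasurableSet ((fun ω : Driver S => ω.2.2 0) ⁻¹' V) :=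
      (by fun_prop : Measurable fun ω : Driver S => ω.2.2 0) hV
    rw [setLIntegral_congr hset, setLIntegral_congr hset,
      setLIntegral_state_eq_renewal hφ hκ hB a (ENNReal.add_ne_top.2 ⟨hs, ht⟩) hV]
    have h1 : ∫⁻ g in V, renewal μ φ κ B a (s + t) (stay μ a g) ∂(expMeasure 1) =
        ∫⁻ g in V, renewal μ φ κ B a t (stay μ a g - s) ∂(expMeasure 1) := by
      refine setLIntegral_congr_fun hV fun g hg => ?_
      have hg : s < stay μ a g := hg
      simp only [renewal]
      have e : s + t < stay μ a g ↔ t < stay μ a g - s := by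
        rw [lt_tsub_iff_left]
      by_cases h : s + t < stay μ a g
      · rw [if_pos h, if_pos (e.1 h)]
      · rw [if_neg h, if_neg (fun h' => h (e.2 h'))]
        have : s + t - stay μ a g = t - (stay μ a g - s) := by
          obtain ⟨y, hy⟩ := exists_add_of_le hg.le
          rw [hy, tsub_add_eq_tsub_tsub, ENNReal.add_sub_cancel_left hs,
            ENNReal.add_sub_cancel_left hs]
        rw [this]
    have h2 : ∫⁻ ω in (fun ω : Driver S => ω.2.2 0) ⁻¹' V, transProb μ φ B t (state μ φ s ω)
        ∂(driverLaw S a) = expMeasure 1 V * transProb μ φ B t a := by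
      have hc : ∀ᵐ ω ∂(driverLaw S a), ω ∈ (fun ω : Driver S => ω.2.2 0) ⁻¹' V →
          transProb μ φ B t (state μ φ s ω) = transProb μ φ B t a := by
        filter_upwards [ae_fst_eq a] with ω hω hm
        rw [state_of_lt_stay, hω]
        rw [hω]
        exact hm
      rw [setLIntegral_congr_fun_ae hV' hc, lintegral_const, Measure.restrict_apply_univ, mul_comm]
      congr 1
      have := lintegral_driverLaw_shift hφ hκ a (F := fun p => V.indicator 1 p.1)
        ((measurable_one.indicator hV).comp measurable_fst)
      rw [← lintegral_indicator_one hV', ← lintegral_indicator_one hV]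
      refine Eq.trans this ?_
      simp
    rw [h1, h2, transProb_eq_lintegral_renewal hφ hκ hB a ht]
    exact stay_memoryless hr a hs (measurable_renewal hφ hB a t)
  · have h0 : driverLaw S a (window μ φ 0 s W) = 0 := by
      rw [measure_eq_zero_iff_ae_notMem]
      filter_upwards [hmem] with ω hω using fun hm => haW (hω.1 hm).2
    rw [setLIntegral_measure_zero _ _ h0, setLIntegral_measure_zero _ _ h0]

/-- Induction on the number of jumps: the first jump reduces `s` by the first stay, turns `W` into a
preimage under `delay`, and moves the starting point, hence the quantifiers after `n`. -/
lemma window_markov [MeasurableSingletonClass S] (hr : IsRateKernel μ)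
    (hφ : Measurable (Function.uncurry φ)) {κ : Kernel S S} [IsMarkovKernel κ]
    (hκ : ∀ a, (volume : Measure I).map (φ a) = κ a) {B : Set S} (hB : MeasurableSet B)
    {t : ℝ≥0∞} (ht : t ≠ ∞) (n : ℕ) :
    ∀ s : ℝ≥0∞, s ≠ ∞ → ∀ W : Set (ℝ≥0∞ → S), MeasurableSet W → ∀ a : S,
    ∫⁻ ω in window μ φ n s W, B.indicator 1 (state μ φ (s + t) ω) ∂(driverLaw S a) =
      ∫⁻ ω in window μ φ n s W, transProb μ φ B t (state μ φ s ω) ∂(driverLaw S a) := by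
  classical
  have hBm : Measurable (B.indicator (1 : S → ℝ≥0∞)) := measurable_one.indicator hB
  induction n with
  | zero => exact fun s hs W _ a => window_markov_zero hr hφ hκ hB ht hs W a
  | succ n ih =>
    intro s hs W hW a
    have e1 := setLIntegral_window_succ (μ := μ) hφ hκ hs hW
      (K := fun s ω => B.indicator 1 (state μ φ (s + t) ω))
      (hBm.comp (measurable_state_comp hφ (measurable_fst.add measurable_const) measurable_snd))
      (fun ω h => by
        rw [state_of_stay_le (ENNReal.add_ne_top.2 ⟨hs, ht⟩) (h.trans le_self_add),
          (ENNReal.cancel_of_ne (ne_top_of_le_ne_top hs h)).tsub_add_eq_add_tsub h]) n a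
    have e2 := setLIntegral_window_succ (μ := μ) hφ hκ hs hW
      (K := fun s ω => transProb μ φ B t (state μ φ s ω))
      ((measurable_transProb hφ hB t).comp (measurable_state hφ))
      (fun ω h => by rw [state_of_stay_le hs h]) n a
    refine e1.trans (Eq.trans ?_ e2.symm)
    refine lintegral_congr fun g => lintegral_congr fun b => ?_
    split_ifs with h
    · exact ih _ (ENNReal.sub_ne_top hs) _ (measurable_delay a s _ hW) b
    · rfl

lemma state_markov [MeasurableSingletonClass S] (hr : IsRateKernel μ)
    (hφ : Measurable (Function.uncurry φ)) {κ : Kernel S S} [IsMarkovKernel κ]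
    (hκ : ∀ a, (volume : Measure I).map (φ a) = κ a) {a : S}
    (hexp : ∀ᵐ ω ∂(driverLaw S a), Tendsto (fun n => epoch μ φ n ω) atTop (𝓝 ∞))
    (s t : ℝ≥0) {B : Set S} (hB : MeasurableSet B) :
    (driverLaw S a)⟦state μ φ ((s + t : ℝ≥0) : ℝ≥0∞) ⁻¹' B |
        pastSigma (fun t : ℝ≥0 => state μ φ (t : ℝ≥0∞)) s⟧ =ᵐ[driverLaw S a]
      fun ω => (transProb μ φ B t (state μ φ s ω)).toReal := by
  have hle : pastSigma (fun t : ℝ≥0 => state μ φ (t : ℝ≥0∞)) s ≤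
      (inferInstance : MeasurableSpace (Driver S)) :=
    iSup₂_le fun k _ => (measurable_state_right hφ _).comap_le
  refine condExp_indicator_ae_eq hle (measurable_state_right hφ _ hB)
    (p := fun ω => transProb μ φ B t (state μ φ s ω)) ?_ (fun ω => prob_le_one) fun A hA => ?_
  · refine (measurable_transProb hφ hB t).comp (Measurable.of_comap_le ?_)
    exact le_iSup₂_of_le s le_rfl le_rfl
  · obtain ⟨W, hW, rfl⟩ := pastSigma_state_le s A hA
    -- Non-explosion enters here: almost surely only finitely many jumps occur before `s`, so the
    -- windows exhaust the event.
    have hset : hist μ φ s ⁻¹' W =ᵐ[driverLaw S a] ⋃ n, window μ φ n s W := by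
      rw [eventuallyEq_set]
      filter_upwards [hexp] with ω hω
      rw [Set.mem_iUnion]
      constructor
      · intro h
        obtain ⟨n, hn⟩ := exists_epoch_le_lt (μ := μ) (φ := φ) (ω := ω) (t := s)
          (((tendsto_add_atTop_iff_nat 1).2 hω).eventually (lt_mem_nhds ENNReal.coe_lt_top)).exists
        exact ⟨n, hn, h⟩
      · rintro ⟨n, hn⟩
        exact hn.2
    have hdisj : Pairwise (Function.onFun Disjoint fun n => window μ φ n s W) := by
      refine (pairwise_disjoint_on _).2 fun m n hmn => ?_
      refine Set.disjoint_left.2 fun ω hm hn => ?_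
      exact absurd (hm.1.2.trans_le ((monotone_epoch ω hmn).trans hn.1.1)) (lt_irrefl _)
    rw [setLIntegral_congr hset, setLIntegral_congr hset,
      lintegral_iUnion (fun n => measurableSet_window hφ n s hW) hdisj,
      lintegral_iUnion (fun n => measurableSet_window hφ n s hW) hdisj]
    refine tsum_congr fun n => ?_
    have := window_markov hr hφ hκ hB ENNReal.coe_ne_top (t := t) n s ENNReal.coe_ne_top W hW a
    rw [← this, ENNReal.coe_add]
    rfl

end StateMarkov

/-! ### Balance of the jump flow under `π` -/

section Balance

variable {S : Type*} [MeasurableSpace S]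

lemma isMarkovKernel_jumpKernel {μ : Kernel S S} (hr : IsRateKernel μ) :
    IsMarkovKernel (jumpKernel μ) := by
  classical
  refine ⟨fun a => ⟨?_⟩⟩
  change (if totalRate μ a = 0 then Measure.dirac a else (totalRate μ a)⁻¹ • μ a) Set.univ = 1
  split_ifs with h
  · simp
  · rw [Measure.smul_apply, smul_eq_mul]
    exact ENNReal.inv_mul_cancel h (hr a).ne

lemma rate_mul_lintegral_jumpKernel {μ : Kernel S S} (hr : IsRateKernel μ) (a : S)
    (f : S → ℝ≥0∞) : totalRate μ a * ∫⁻ b, f b ∂(jumpKernel μ a) = ∫⁻ b, f b ∂(μ a) := by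
  classical
  by_cases h : totalRate μ a = 0
  · have : μ a = 0 := Measure.measure_univ_eq_zero.1 h
    rw [h, this, zero_mul, lintegral_zero_measure]
  · have : jumpKernel μ a = (totalRate μ a)⁻¹ • μ a := by
      change (if totalRate μ a = 0 then Measure.dirac a else (totalRate μ a)⁻¹ • μ a) = _
      rw [if_neg h]
    rw [this, lintegral_smul_measure, smul_eq_mul, ← mul_assoc,
      ENNReal.mul_inv_cancel h (hr a).ne, one_mul]

/-- The measure `π` has no net flow under the rate kernel `μ`. -/
def Balanced (π : Measure S) (μ : Kernel S S) : Prop :=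
  ∀ f : S → ℝ≥0∞, Measurable f →
    ∫⁻ a, ∫⁻ b, f b ∂(μ a) ∂π = ∫⁻ a, totalRate μ a * f a ∂π

lemma balanced_of_halfSkewBalance {π : Measure S} {𝔰 : S → S} (h_pres : MeasurePreserving 𝔰 π π)
    {μ : Kernel S S} (h_rate : IsRateKernel μ) (h_fin : ∫⁻ a, totalRate μ a ∂π < ∞)
    (h_skew : HalfSkewBalance π 𝔰 μ) (h_semi : ∀ a, totalRate μ a = totalRate μ (𝔰 a)) :
    Balanced π μ := by
  have hset : ∀ B, MeasurableSet B → ∫⁻ a, μ a B ∂π = ∫⁻ a in B, totalRate μ a ∂π := by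
    intro B hB
    have hfinite : ∀ a, IsFiniteMeasure (μ a) := fun a => ⟨h_rate a⟩
    have h := h_skew (B.indicator 1) (measurable_one.indicator hB)
      ⟨1, fun x => by by_cases hx : x ∈ B <;> simp [hx]⟩
    have h1 : ∫ a, (∫ b, B.indicator (1 : S → ℝ) b ∂(μ a)) ∂π = (∫⁻ a, μ a B ∂π).toReal := by
      simp_rw [integral_indicator_one hB]
      exact integral_toReal (μ.measurable_coe hB).aemeasurable
        (Eventually.of_forall fun a => measure_lt_top _ _)
    have hmeas : Measurable fun a => totalRate μ a * B.indicator 1 (𝔰 a) :=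
      (measurable_totalRate μ).mul ((measurable_one.indicator hB).comp h_pres.measurable)
    have h2 : ∫ b', (∫ _a', B.indicator (1 : S → ℝ) (𝔰 b') ∂(μ b')) ∂π =
        (∫⁻ a, totalRate μ a * B.indicator 1 (𝔰 a) ∂π).toReal := by
      rw [← integral_toReal hmeas.aemeasurable]
      · refine integral_congr_ae (Eventually.of_forall fun a => ?_)
        simp only [integral_const, smul_eq_mul, ENNReal.toReal_mul]
        congr 1
        by_cases hx : 𝔰 a ∈ B <;> simp [hx]
      · refine Eventually.of_forall fun a => ENNReal.mul_lt_top (h_rate a) ?_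
        by_cases hx : 𝔰 a ∈ B <;> simp [hx]
    -- Since `λ(a) = λ(𝔰 a)`, the integrand is `1_B λ` composed with `𝔰`, and `𝔰` preserves `π`.
    have h3 : ∫⁻ a, totalRate μ a * B.indicator 1 (𝔰 a) ∂π = ∫⁻ a in B, totalRate μ a ∂π := by
      rw [lintegral_congr (g := fun a => B.indicator (totalRate μ) (𝔰 a)),
        h_pres.lintegral_comp ((measurable_totalRate μ).indicator hB), lintegral_indicator hB]
      intro a
      by_cases hx : 𝔰 a ∈ B
      · simp [hx, h_semi a]
      · simp [hx]
    rw [h1, h2, h3] at h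
    -- Equality of real parts lifts to `ℝ≥0∞` because both sides are at most `∫ λ dπ < ∞`.
    refine (ENNReal.toReal_eq_toReal_iff' ?_ ?_).1 h
    · exact ((lintegral_mono fun a => measure_mono (Set.subset_univ B)).trans_lt h_fin).ne
    · exact ((setLIntegral_le_lintegral _ _).trans_lt h_fin).ne
  have hmeas : π.bind μ = π.withDensity (totalRate μ) := by
    ext B hB
    rw [Measure.bind_apply hB μ.aemeasurable, withDensity_apply _ hB, hset B hB]
  intro f hf
  have h := Measure.lintegral_bind (m := π) (μ := μ) (f := f) μ.aemeasurable hf.aemeasurable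
  rw [← h, hmeas, lintegral_withDensity_eq_lintegral_mul _ (measurable_totalRate μ) hf]
  rfl

lemma Balanced.congr {π : Measure S} {μ μ' : Kernel S S} (h : Balanced π μ)
    (hae : ∀ᵐ a ∂π, μ' a = μ a) : Balanced π μ' := by
  intro f hf
  have h1 : ∫⁻ a, ∫⁻ b, f b ∂(μ' a) ∂π = ∫⁻ a, ∫⁻ b, f b ∂(μ a) ∂π :=
    lintegral_congr_ae (by filter_upwards [hae] with a ha; rw [ha])
  have h2 : ∫⁻ a, totalRate μ' a * f a ∂π = ∫⁻ a, totalRate μ a * f a ∂π :=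
    lintegral_congr_ae (by filter_upwards [hae] with a ha; rw [totalRate, totalRate, ha])
  rw [h1, h2, h f hf]

end Balance

/-! ### Explosion is `π`-negligible and can be removed -/

section Explosion

/-- The function `x ↦ exp (-x)` on `[0, ∞]`. -/
noncomputable def decay (x : ℝ≥0∞) : ℝ≥0∞ := EReal.exp (-(x : EReal))

lemma measurable_decay : Measurable decay := by
  unfold decay
  fun_prop

lemma decay_add (x y : ℝ≥0∞) : decay (x + y) = decay x * decay y := by
  rw [decay, decay, decay, ← EReal.exp_add, EReal.coe_ennreal_add, EReal.neg_add]
  · rfl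
  · exact Or.inl (EReal.coe_ennreal_ne_bot x)
  · exact Or.inr (EReal.coe_ennreal_ne_bot y)

lemma decay_zero : decay 0 = 1 := by simp [decay]

lemma decay_top : decay ∞ = 0 := by simp [decay]

lemma decay_eq_zero_iff {x : ℝ≥0∞} : decay x = 0 ↔ x = ∞ := by
  simp [decay]

lemma decay_antitone : Antitone decay := fun _ _ h =>
  EReal.exp_monotone (EReal.neg_le_neg_iff.2 (EReal.coe_ennreal_le_coe_ennreal_iff.2 h))

lemma decay_lt_one {x : ℝ≥0∞} (hx : 0 < x) : decay x < 1 := by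
  rw [decay, EReal.exp_lt_one_iff]
  rw [EReal.neg_lt_comm, neg_zero]
  exact EReal.coe_ennreal_pos.2 hx

lemma decay_le_one (x : ℝ≥0∞) : decay x ≤ 1 := by
  rw [← decay_zero]
  exact decay_antitone zero_le

variable {S : Type*} [MeasurableSpace S]

/-- The Laplace transform at `1` of the duration of a stay at `a`. -/
noncomputable def meanDecay (μ : Kernel S S) (a : S) : ℝ≥0∞ :=
  ∫⁻ g, decay (stay μ a g) ∂(expMeasure 1)

lemma measurable_meanDecay (μ : Kernel S S) : Measurable (meanDecay μ) := by
  unfold meanDecay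
  refine Measurable.lintegral_prod_right' (f := fun p : S × ℝ => decay (stay μ p.1 p.2)) ?_
  exact measurable_decay.comp (measurable_stay μ)

lemma meanDecay_of_rate_eq_zero {μ : Kernel S S} {a : S} (h : totalRate μ a = 0) :
    meanDecay μ a = 0 := by
  rw [meanDecay, lintegral_congr_ae (g := fun _ => 0), lintegral_zero]
  filter_upwards [ae_pos_expMeasure] with g hg
  rw [stay_of_rate_eq_zero h hg, decay_top]

/-- A finite rate makes the stay almost surely positive. This strictness is what rules out
explosion. -/
lemma meanDecay_lt_one {μ : Kernel S S} (hr : IsRateKernel μ) (a : S) : meanDecay μ a < 1 := by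
  have hle : meanDecay μ a ≤ ∫⁻ _g, 1 ∂(expMeasure 1) :=
    lintegral_mono fun g => decay_le_one _
  have h1 : ∫⁻ _g, (1 : ℝ≥0∞) ∂(expMeasure 1) = 1 := by simp
  rw [← h1]
  refine lintegral_strict_mono (NeZero.ne _) measurable_const.aemeasurable ?_ ?_
  · exact ne_top_of_le_ne_top (by simp) hle
  · filter_upwards [ae_pos_expMeasure] with g hg
    exact decay_lt_one (ENNReal.div_pos (ENNReal.ofReal_pos.2 hg).ne' (hr a).ne)

/-- The expectation of `exp (-τ_n)` for the trajectory started at `a`. -/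
noncomputable def epochDecay (μ : Kernel S S) : ℕ → S → ℝ≥0∞
  | 0, _ => 1
  | n + 1, a => meanDecay μ a * ∫⁻ b, epochDecay μ n b ∂(jumpKernel μ a)

/-- The expectation of `exp (-ζ)`, where `ζ` is the explosion time. -/
noncomputable def explosionDecay (μ : Kernel S S) (a : S) : ℝ≥0∞ := ⨅ n, epochDecay μ n a

lemma measurable_epochDecay (μ : Kernel S S) (n : ℕ) : Measurable (epochDecay μ n) := by
  induction n with
  | zero => exact measurable_const
  | succ n ih => exact (measurable_meanDecay μ).mul ih.lintegral_kernel

lemma measurable_explosionDecay (μ : Kernel S S) : Measurable (explosionDecay μ) :=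
  Measurable.iInf (measurable_epochDecay μ)

lemma epochDecay_le_one {μ : Kernel S S} (hr : IsRateKernel μ) (n : ℕ) (a : S) :
    epochDecay μ n a ≤ 1 := by
  have := isMarkovKernel_jumpKernel hr
  induction n generalizing a with
  | zero => exact le_rfl
  | succ n ih =>
    refine mul_le_one' (meanDecay_lt_one hr a).le ?_
    exact (lintegral_mono ih).trans (by simp)

lemma epochDecay_antitone {μ : Kernel S S} (hr : IsRateKernel μ) (a : S) :
    Antitone fun n => epochDecay μ n a := by
  refine antitone_nat_of_succ_le fun n => ?_
  induction n generalizing a with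
  | zero => exact epochDecay_le_one hr 1 a
  | succ n ih =>
    change meanDecay μ a * _ ≤ meanDecay μ a * _
    gcongr
    exact ih _

/-- Pass to the limit in the recursion for `epochDecay`: the sequence decreases and is bounded by
`1`, so the infimum commutes with the integral. -/
lemma explosionDecay_eq {μ : Kernel S S} (hr : IsRateKernel μ) (a : S) :
    explosionDecay μ a = meanDecay μ a * ∫⁻ b, explosionDecay μ b ∂(jumpKernel μ a) := by
  have := isMarkovKernel_jumpKernel hr
  have h1 : ∫⁻ b, explosionDecay μ b ∂(jumpKernel μ a) =
      ⨅ n, ∫⁻ b, epochDecay μ n b ∂(jumpKernel μ a) := by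
    unfold explosionDecay
    refine lintegral_iInf (measurable_epochDecay μ)
      (fun m n hmn b => epochDecay_antitone hr b hmn) ?_
    exact ne_top_of_le_ne_top ENNReal.one_ne_top
      ((lintegral_mono fun b => epochDecay_le_one hr 0 b).trans (by simp))
  have hne : meanDecay μ a ≠ ∞ := (meanDecay_lt_one hr a).ne_top
  rw [h1, ENNReal.mul_iInf fun h => absurd h hne]
  exact ((epochDecay_antitone hr a).iInf_nat_add 1).symm

/-- Balance applied to `h = explosionDecay μ` gives `∫ G = ∫ m G` with `G = μh` and `m = meanDecay
μ`. As `m G ≤ G` and `∫ G ≤ ∫ λ < ∞`, equality holds almost everywhere, and `m < 1` leaves only `G =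
0`. -/
lemma explosionDecay_ae_eq_zero {π : Measure S} {μ : Kernel S S} (hr : IsRateKernel μ)
    (hfin : ∫⁻ a, totalRate μ a ∂π < ∞) (hbal : Balanced π μ) :
    ∀ᵐ a ∂π, explosionDecay μ a = 0 := by
  have hm := measurable_explosionDecay μ
  have hle : ∀ a, explosionDecay μ a ≤ 1 := fun a => (iInf_le _ 0).trans (epochDecay_le_one hr 0 a)
  let G : S → ℝ≥0∞ := fun a => ∫⁻ b, explosionDecay μ b ∂(μ a)
  have hG : Measurable G := hm.lintegral_kernel
  have hGeq : ∀ a, totalRate μ a * explosionDecay μ a = meanDecay μ a * G a := fun a => by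
    rw [explosionDecay_eq hr a, mul_left_comm, rate_mul_lintegral_jumpKernel hr]
  have hb := hbal _ hm
  simp_rw [hGeq] at hb
  have hGle : ∀ a, G a ≤ totalRate μ a := fun a => by
    refine (lintegral_mono hle).trans ?_
    simp [totalRate]
  have hGfin : ∫⁻ a, G a ∂π ≠ ∞ := ((lintegral_mono hGle).trans_lt hfin).ne
  have hmul : (fun a => meanDecay μ a * G a) ≤ᵐ[π] G := Eventually.of_forall fun a =>
    mul_le_of_le_one_left zero_le (meanDecay_lt_one hr a).le
  have hae := ae_eq_of_ae_le_of_lintegral_le hmul (hb ▸ hGfin) hG.aemeasurable hb.le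
  filter_upwards [hae] with a ha
  have ha : meanDecay μ a * G a = G a := ha
  have hG0 : G a = 0 := by
    by_contra h
    have hlt := ENNReal.mul_lt_mul_left h ((hGle a).trans_lt (hr a)).ne (meanDecay_lt_one hr a)
    rw [ha, one_mul] at hlt
    exact lt_irrefl _ hlt
  -- Where `λ > 0`, `λh = mG = 0` yields `h = 0`. Where `λ = 0` the stay is infinite and `h`
  -- vanishes through `m = 0`.
  by_cases h0 : totalRate μ a = 0
  · rw [explosionDecay_eq hr, meanDecay_of_rate_eq_zero h0, zero_mul]
  · have := hGeq a
    rw [hG0, mul_zero] at this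
    exact (mul_eq_zero.1 this).resolve_left h0

open Classical in
/-- A rate kernel without explosion that agrees with `μ` where `μ` does not explode. -/
noncomputable def nonexplosive (μ : Kernel S S) : Kernel S S :=
  Kernel.piecewise (measurable_explosionDecay μ (measurableSet_singleton 0)) μ 0

open Classical in
lemma nonexplosive_of_eq {μ : Kernel S S} {a : S} (h : explosionDecay μ a = 0) :
    nonexplosive μ a = μ a := by
  rw [nonexplosive, Kernel.piecewise_apply]
  exact if_pos h

open Classical in
lemma nonexplosive_of_ne {μ : Kernel S S} {a : S} (h : explosionDecay μ a ≠ 0) :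
    nonexplosive μ a = 0 := by
  rw [nonexplosive, Kernel.piecewise_apply]
  exact if_neg h

lemma isRateKernel_nonexplosive {μ : Kernel S S} (hr : IsRateKernel μ) :
    IsRateKernel (nonexplosive μ) := by
  intro a
  by_cases h : explosionDecay μ a = 0
  · rw [totalRate, nonexplosive_of_eq h]; exact hr a
  · rw [totalRate, nonexplosive_of_ne h]; simp

/-- Freezing points can only delay jumps: an unmodified point keeps its stay and jump law, and a
frozen one has an infinite stay. -/
lemma epochDecay_nonexplosive_le (μ : Kernel S S) (n : ℕ) (a : S) :
    epochDecay (nonexplosive μ) n a ≤ epochDecay μ n a := by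
  classical
  induction n generalizing a with
  | zero => exact le_rfl
  | succ n ih =>
    by_cases h : explosionDecay μ a = 0
    · have ha := nonexplosive_of_eq h
      have hr : totalRate (nonexplosive μ) a = totalRate μ a := by rw [totalRate, totalRate, ha]
      have h1 : meanDecay (nonexplosive μ) a = meanDecay μ a := by
        simp only [meanDecay, stay, hr]
      have h2 : jumpKernel (nonexplosive μ) a = jumpKernel μ a := by
        change (if _ = _ then _ else _) = (if _ = _ then _ else _)
        rw [hr, ha]
      rw [epochDecay, epochDecay, h1, h2]
      gcongr
      exact ih _
    · have h0 : totalRate (nonexplosive μ) a = 0 := by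
        rw [totalRate, nonexplosive_of_ne h]; simp
      rw [epochDecay, meanDecay_of_rate_eq_zero h0, zero_mul]
      exact zero_le

lemma explosionDecay_nonexplosive {μ : Kernel S S} (hr : IsRateKernel μ) (a : S) :
    explosionDecay (nonexplosive μ) a = 0 := by
  by_cases h : explosionDecay μ a = 0
  · exact le_antisymm ((iInf_mono fun n => epochDecay_nonexplosive_le μ n a).trans h.le) zero_le
  · have h0 : totalRate (nonexplosive μ) a = 0 := by
      rw [totalRate, nonexplosive_of_ne h]; simp
    rw [explosionDecay_eq (isRateKernel_nonexplosive hr), meanDecay_of_rate_eq_zero h0, zero_mul]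

/-- `epochDecay` is built from the kernel alone, so that `nonexplosive` can be fixed before `φ` is
chosen. Here it acquires its probabilistic meaning, the stay and the later epochs being independent
given the jump. -/
lemma lintegral_decay_epoch [MeasurableSingletonClass S] {φ : S → I → S} {μ : Kernel S S}
    (hφ : Measurable (Function.uncurry φ))
    (hκ : ∀ a, (volume : Measure I).map (φ a) = jumpKernel μ a) (n : ℕ) (a : S) :
    ∫⁻ ω, decay (epoch μ φ n ω) ∂(driverLaw S a) = epochDecay μ n a := by
  induction n generalizing a with
  | zero => simp [epoch_zero, decay_zero, epochDecay]
  | succ n ih =>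
    have hst : Measurable fun p : ℝ × Driver S => decay (stay μ a p.1) :=
      measurable_decay.comp ((measurable_stay_right a).comp measurable_fst)
    have hep : Measurable fun ω => decay (epoch μ φ n ω) :=
      measurable_decay.comp (measurable_epoch hφ n)
    have hF : Measurable fun p : ℝ × Driver S =>
        decay (stay μ a p.1) * decay (epoch μ φ n p.2) := hst.mul (hep.comp measurable_snd)
    have h := lintegral_driverLaw_shift hφ hκ a hF
    have h1 : ∫⁻ ω, decay (epoch μ φ (n + 1) ω) ∂(driverLaw S a) =
        ∫⁻ ω, decay (stay μ a (ω.2.2 0)) * decay (epoch μ φ n (shift φ ω)) ∂(driverLaw S a) := by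
      refine lintegral_congr_ae ?_
      filter_upwards [ae_fst_eq a] with ω hω
      rw [epoch_succ, decay_add, hω]
    rw [h1]
    refine h.trans ?_
    simp only [lintegral_const_mul _ hep, ih]
    simp only [lintegral_const_mul _ (measurable_epochDecay μ n)]
    exact lintegral_mul_const _ (measurable_decay.comp (measurable_stay_right a))

lemma ae_tendsto_epoch [MeasurableSingletonClass S] {φ : S → I → S} {μ : Kernel S S}
    (hφ : Measurable (Function.uncurry φ))
    (hκ : ∀ a, (volume : Measure I).map (φ a) = jumpKernel μ a) {a : S}
    (ha : explosionDecay μ a = 0) :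
    ∀ᵐ ω ∂(driverLaw S a), Tendsto (fun n => epoch μ φ n ω) atTop (𝓝 ∞) := by
  have hm : Measurable fun ω => decay (⨆ n, epoch μ φ n ω) :=
    measurable_decay.comp (Measurable.iSup (measurable_epoch hφ))
  have h0 : ∫⁻ ω, decay (⨆ n, epoch μ φ n ω) ∂(driverLaw S a) = 0 := by
    refine le_antisymm ?_ zero_le
    rw [← ha]
    refine le_iInf fun n => ?_
    rw [← lintegral_decay_epoch hφ hκ]
    exact lintegral_mono fun ω => decay_antitone (le_iSup (fun n => epoch μ φ n ω) n)
  filter_upwards [(lintegral_eq_zero_iff hm).1 h0] with ω hω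
  rw [← decay_eq_zero_iff.1 hω]
  exact tendsto_atTop_iSup (monotone_epoch ω)

end Explosion

/-! ### The renewal equation for exponential holding times -/

section ExponentialConvolution

/-- An exponential time of rate `l` started at `q` ends either after `T` or before it. -/
lemma exp_add_lintegral_exp (l : ℝ) (hl : 0 < l) {q T : ℝ} (h : q ≤ T) :
    ENNReal.ofReal (Real.exp (-(l * (T - q)))) +
      ∫⁻ r in Set.Ioc q T, ENNReal.ofReal (l * Real.exp (-(l * (r - q)))) = 1 := by
  have hcont : Continuous fun r : ℝ => l * Real.exp (-(l * (r - q))) := by fun_prop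
  have hint : ∫ r in q..T, l * Real.exp (-(l * (r - q))) = 1 - Real.exp (-(l * (T - q))) := by
    rw [intervalIntegral.integral_eq_sub_of_hasDerivAt
      (f := fun r => -Real.exp (-(l * (r - q))))
      (fun r _ => (hasDerivAt_neg_exp_mul_exp (r := l)).comp_sub_const r q)
      (hcont.intervalIntegrable _ _)]
    simp
    ring
  have hle : Real.exp (-(l * (T - q))) ≤ 1 :=
    Real.exp_le_one_iff.2 (neg_nonpos.2 (mul_nonneg hl.le (sub_nonneg.2 h)))
  rw [← ofReal_integral_eq_lintegral_ofReal, ← intervalIntegral.integral_of_le h, hint,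
    ← ENNReal.ofReal_add (Real.exp_nonneg _) (sub_nonneg.2 hle)]
  · simp
  · exact (hcont.intervalIntegrable q T).1
  · exact Eventually.of_forall fun r => by positivity

/-- The solution of the renewal equation for holding times of rate `l`, with value `c` before the
renewal time and value `w` of the remaining time after it. -/
noncomputable def expRenewal (l : ℝ) (c : ℝ≥0∞) (w : ℝ → ℝ≥0∞) (r : ℝ) : ℝ≥0∞ :=
  ENNReal.ofReal (Real.exp (-(l * r))) * c +
    ∫⁻ q in Set.Ioc 0 r, ENNReal.ofReal (l * Real.exp (-(l * (r - q)))) * w q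

lemma setLIntegral_triangle {F : ℝ → ℝ → ℝ≥0∞} (hF : Measurable (Function.uncurry F)) (T : ℝ) :
    ∫⁻ r in Set.Ioc 0 T, ∫⁻ q in Set.Ioc 0 r, F r q =
      ∫⁻ q in Set.Ioc 0 T, ∫⁻ r in Set.Ioc q T, F r q := by
  have hset : MeasurableSet {p : ℝ × ℝ | p.2 ≤ p.1} := measurableSet_le measurable_snd measurable_fst
  have h1 : ∀ r ∈ Set.Ioc 0 T, ∫⁻ q in Set.Ioc 0 r, F r q =
      ∫⁻ q in Set.Ioc 0 T, {p : ℝ × ℝ | p.2 ≤ p.1}.indicator (Function.uncurry F) (r, q) := by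
    intro r hr
    rw [← lintegral_indicator measurableSet_Ioc, ← lintegral_indicator measurableSet_Ioc]
    refine lintegral_congr fun q => ?_
    by_cases h0 : 0 < q
    · by_cases hq : q ≤ r
      · simp [Set.indicator, h0, hq, hq.trans hr.2]
      · simp [Set.indicator, hq]
    · simp [Set.indicator, h0]
  have h2 : ∀ q ∈ Set.Ioc 0 T, ∫⁻ r in Set.Ioc q T, F r q =
      ∫⁻ r in Set.Ioc 0 T, {p : ℝ × ℝ | p.2 ≤ p.1}.indicator (Function.uncurry F) (r, q) := by
    intro q hq
    -- The triangle contains its diagonal `r = q`, which `Ioc q T` omits.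
    rw [setLIntegral_congr (Ioc_ae_eq_Icc (a := q) (b := T)),
      ← lintegral_indicator measurableSet_Ioc, ← lintegral_indicator measurableSet_Icc]
    refine lintegral_congr fun r => ?_
    by_cases h0 : q ≤ r
    · simp [Set.indicator, h0, hq.1.trans_le h0]
    · simp [Set.indicator, h0]
  rw [setLIntegral_congr_fun measurableSet_Ioc h1, setLIntegral_congr_fun measurableSet_Ioc h2]
  exact lintegral_lintegral_swap (hF.indicator hset).aemeasurable

/-- The integrated form of `v' = l (w - v)`, `v(0) = c`. Tonelli replaces differentiation, so
measurability of `w` suffices: after exchanging the integrals, the weights of `c` and of each `w q`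
collapse by `exp_add_lintegral_exp`. -/
lemma expRenewal_add_lintegral {l : ℝ} (hl : 0 < l) (c : ℝ≥0∞) {w : ℝ → ℝ≥0∞}
    (hw : Measurable w) {T : ℝ} (hT : 0 ≤ T) :
    expRenewal l c w T + ENNReal.ofReal l * ∫⁻ r in Set.Ioc 0 T, expRenewal l c w r =
      c + ENNReal.ofReal l * ∫⁻ q in Set.Ioc 0 T, w q := by
  have hk : Measurable fun p : ℝ × ℝ =>
      ENNReal.ofReal (l * Real.exp (-(l * (p.1 - p.2)))) * w p.2 := by fun_prop
  have hA : Measurable fun r : ℝ => ENNReal.ofReal (Real.exp (-(l * r))) := by fun_prop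
  have h1 : ENNReal.ofReal l * ∫⁻ r in Set.Ioc 0 T, ENNReal.ofReal (Real.exp (-(l * r))) * c =
      (∫⁻ r in Set.Ioc 0 T, ENNReal.ofReal (l * Real.exp (-(l * (r - 0))))) * c := by
    rw [lintegral_mul_const _ hA, ← mul_assoc, ← lintegral_const_mul _ hA]
    simp_rw [ENNReal.ofReal_mul hl.le, sub_zero]
  have h2 : ENNReal.ofReal l * ∫⁻ r in Set.Ioc 0 T, ∫⁻ q in Set.Ioc 0 r,
        ENNReal.ofReal (l * Real.exp (-(l * (r - q)))) * w q =
      ∫⁻ q in Set.Ioc 0 T, ENNReal.ofReal l *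
        ((∫⁻ r in Set.Ioc q T, ENNReal.ofReal (l * Real.exp (-(l * (r - q))))) * w q) := by
    rw [setLIntegral_triangle
      (F := fun r q => ENNReal.ofReal (l * Real.exp (-(l * (r - q)))) * w q) hk, ← lintegral_const_mul' _ _ ENNReal.ofReal_ne_top]
    refine lintegral_congr fun q => ?_
    rw [lintegral_mul_const _ (by fun_prop)]
  have h3 : (∫⁻ q in Set.Ioc 0 T, ENNReal.ofReal (l * Real.exp (-(l * (T - q)))) * w q) +
      ∫⁻ q in Set.Ioc 0 T, ENNReal.ofReal l *
        ((∫⁻ r in Set.Ioc q T, ENNReal.ofReal (l * Real.exp (-(l * (r - q))))) * w q) =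
      ENNReal.ofReal l * ∫⁻ q in Set.Ioc 0 T, w q := by
    rw [← lintegral_add_left (by fun_prop), ← lintegral_const_mul _ hw]
    refine setLIntegral_congr_fun measurableSet_Ioc fun q hq => ?_
    have := exp_add_lintegral_exp l hl hq.2
    rw [ENNReal.ofReal_mul hl.le, mul_assoc, ← mul_add, ← add_mul, this, one_mul]
  have h4 := exp_add_lintegral_exp l hl hT
  unfold expRenewal
  rw [lintegral_add_left (by fun_prop), mul_add, h1, h2, ← h3]
  rw [sub_zero] at h4
  conv_rhs => rw [← one_mul c, ← h4, add_mul]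
  abel

lemma lintegral_comp_reflect {l : ℝ} (hl : 0 < l) (r : ℝ) {H : ℝ → ℝ≥0∞} (hH : Measurable H) :
    ∫⁻ g, H g = ENNReal.ofReal l * ∫⁻ q, H (l * (r - q)) := by
  rw [lintegral_sub_left_eq_self (fun x => H (l * x)) r,
    ← lintegral_map (f := H) (g := fun x => l * x) hH (by fun_prop),
    Real.map_volume_mul_left hl.ne', lintegral_smul_measure, smul_eq_mul, ← mul_assoc,
    abs_of_pos (inv_pos.2 hl), ← ENNReal.ofReal_mul hl.le, mul_inv_cancel₀ hl.ne',
    ENNReal.ofReal_one, one_mul]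

end ExponentialConvolution

/-! ### Backward equation and stationarity -/

section Stationary

variable {S : Type*} [MeasurableSpace S] [Nonempty S] {φ : S → I → S} {μ : Kernel S S}

/-- The probability of being in `B` a time `r` after the first jump. -/
noncomputable def afterJump (μ : Kernel S S) (φ : S → I → S) (κ : Kernel S S) (B : Set S) (a : S)
    (r : ℝ) : ℝ≥0∞ :=
  ∫⁻ b, transProb μ φ B (ENNReal.ofReal r) b ∂(κ a)

lemma measurable_afterJump_uncurry (hφ : Measurable (Function.uncurry φ)) {κ : Kernel S S}
    [IsMarkovKernel κ] {B : Set S} (hB : MeasurableSet B) :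
    Measurable fun p : S × ℝ => afterJump μ φ κ B p.1 p.2 := by
  unfold afterJump
  have h : Measurable fun q : (S × ℝ) × S => transProb μ φ B (ENNReal.ofReal q.1.2) q.2 :=
    measurable_transProb_comp hφ hB (by fun_prop) measurable_snd
  exact Measurable.lintegral_kernel_prod_right' (κ := κ.comap Prod.fst measurable_fst) h

lemma transProb_eq_expRenewal [MeasurableSingletonClass S] (hr : IsRateKernel μ)
    (hφ : Measurable (Function.uncurry φ)) {κ : Kernel S S} [IsMarkovKernel κ]
    (hκ : ∀ a, (volume : Measure I).map (φ a) = κ a) {B : Set S} (hB : MeasurableSet B)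
    {a : S} (ha : totalRate μ a ≠ 0) {r : ℝ} (h0 : 0 ≤ r) :
    transProb μ φ B (ENNReal.ofReal r) a =
      expRenewal (totalRate μ a).toReal (B.indicator 1 a) (afterJump μ φ κ B a) r := by
  have hl : 0 < (totalRate μ a).toReal := ENNReal.toReal_pos ha (hr a).ne
  have hst := stay_of_rate_ne_zero hr ha
  set l := (totalRate μ a).toReal
  set w := afterJump μ φ κ B a with hw
  set c : ℝ≥0∞ := B.indicator 1 a
  have hwm : Measurable w :=
    (measurable_afterJump_uncurry (μ := μ) (κ := κ) hφ hB).comp (measurable_prodMk_left (x := a))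
  have hre : ∀ g, 0 < g → renewal μ φ κ B a (ENNReal.ofReal r) (stay μ a g) =
      (Set.Ioi (l * r)).indicator (fun _ => c) g +
        (Set.Iic (l * r)).indicator (fun g => w (r - g / l)) g := by
    intro g hg
    rw [renewal, hst]
    have e : ENNReal.ofReal r < ENNReal.ofReal (g / l) ↔ l * r < g := by
      rw [ENNReal.ofReal_lt_ofReal_iff (by positivity), lt_div_iff₀ hl, mul_comm]
    by_cases h : l * r < g
    · rw [if_pos (e.2 h), Set.indicator_of_mem (Set.mem_Ioi.2 h),
        Set.indicator_of_notMem (fun h' => absurd h (not_lt.2 (Set.mem_Iic.1 h'))), add_zero]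
    · rw [if_neg (fun h' => h (e.1 h')), Set.indicator_of_notMem (fun h' => h (Set.mem_Ioi.1 h')),
        Set.indicator_of_mem (Set.mem_Iic.2 (not_lt.1 h)), zero_add, hw, afterJump,
        ENNReal.ofReal_sub _ (by positivity)]
  rw [transProb_eq_lintegral_renewal hφ hκ hB a ENNReal.ofReal_ne_top, expRenewal]
  have hsplit : ∫⁻ g, renewal μ φ κ B a (ENNReal.ofReal r) (stay μ a g) ∂(expMeasure 1) =
      ∫⁻ g, ((Set.Ioi (l * r)).indicator (fun _ => c) g +
        (Set.Iic (l * r)).indicator (fun g => w (r - g / l)) g) ∂(expMeasure 1) := by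
    refine lintegral_congr_ae ?_
    filter_upwards [ae_pos_expMeasure] with g hg using hre g hg
  have hm1 : Measurable ((Set.Ioi (l * r)).indicator fun _ => c) :=
    measurable_const.indicator measurableSet_Ioi
  have hm2 : Measurable ((Set.Iic (l * r)).indicator fun g => w (r - g / l)) :=
    (hwm.comp (by fun_prop)).indicator measurableSet_Iic
  rw [hsplit, lintegral_add_left hm1]
  congr 1
  · rw [lintegral_indicator_const measurableSet_Ioi, expMeasure_Ioi (by positivity), mul_comm]
  · rw [lintegral_expMeasure hm2, ← lintegral_indicator measurableSet_Ioi,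
      lintegral_comp_reflect hl r, ← lintegral_const_mul' _ _ ENNReal.ofReal_ne_top,
      -- In terms of the time `q = r - g / l` left after the jump, `0 < g ≤ l r` becomes `0 ≤ q <
      -- r`; hence `Ico` in place of `Ioc`.
      setLIntegral_congr (Ico_ae_eq_Ioc (a := (0 : ℝ)) (b := r)).symm,
      ← lintegral_indicator measurableSet_Ico]
    · refine lintegral_congr fun q => ?_
      have e1 : 0 < l * (r - q) ↔ q < r := by rw [mul_pos_iff_of_pos_left hl, sub_pos]
      have e2 : l * (r - q) ≤ l * r ↔ 0 ≤ q := by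
        rw [mul_le_mul_iff_right₀ hl, sub_le_self_iff]
      by_cases hq : q < r
      · by_cases hq0 : 0 ≤ q
        · rw [Set.indicator_of_mem (Set.mem_Ioi.2 (e1.2 hq)),
            Set.indicator_of_mem (Set.mem_Iic.2 (e2.2 hq0)),
            Set.indicator_of_mem (Set.mem_Ico.2 ⟨hq0, hq⟩), mul_div_cancel_left₀ _ hl.ne',
            sub_sub_cancel, ← mul_assoc, ← ENNReal.ofReal_mul hl.le]
        · rw [Set.indicator_of_notMem (fun h => hq0 (Set.mem_Ico.1 h).1),
            Set.indicator_of_mem (Set.mem_Ioi.2 (e1.2 hq)),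
            Set.indicator_of_notMem (fun h => hq0 (e2.1 (Set.mem_Iic.1 h))), mul_zero, mul_zero]
      · rw [Set.indicator_of_notMem (fun h => hq (Set.mem_Ico.1 h).2),
          Set.indicator_of_notMem (fun h => hq (e1.1 (Set.mem_Ioi.1 h))), mul_zero]
    · exact Measurable.indicator (by fun_prop) measurableSet_Ioi

/-- Kolmogorov's backward equation, integrated in time and arranged so that no subtraction occurs in
`ℝ≥0∞`. At an absorbing point both integral terms vanish. -/
lemma transProb_backward [MeasurableSingletonClass S] (hr : IsRateKernel μ)
    (hφ : Measurable (Function.uncurry φ)) {κ : Kernel S S} [IsMarkovKernel κ]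
    (hκ : ∀ a, (volume : Measure I).map (φ a) = κ a) {B : Set S} (hB : MeasurableSet B)
    (a : S) {T : ℝ} (hT : 0 ≤ T) :
    transProb μ φ B (ENNReal.ofReal T) a +
        totalRate μ a * ∫⁻ r in Set.Ioc 0 T, transProb μ φ B (ENNReal.ofReal r) a =
      B.indicator 1 a + totalRate μ a * ∫⁻ r in Set.Ioc 0 T, afterJump μ φ κ B a r := by
  by_cases ha : totalRate μ a = 0
  · rw [ha, zero_mul, zero_mul, add_zero, add_zero,
      transProb_eq_lintegral_renewal hφ hκ hB a ENNReal.ofReal_ne_top,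
      lintegral_congr_ae (g := fun _ => B.indicator 1 a)]
    · simp
    · filter_upwards [ae_pos_expMeasure] with g hg
      rw [renewal, stay_of_rate_eq_zero ha hg, if_pos ENNReal.ofReal_lt_top]
  · have hl : 0 < (totalRate μ a).toReal := ENNReal.toReal_pos ha (hr a).ne
    have hwm : Measurable (afterJump μ φ κ B a) :=
      (measurable_afterJump_uncurry (μ := μ) (κ := κ) hφ hB).comp (measurable_prodMk_left (x := a))
    have h := expRenewal_add_lintegral hl (B.indicator 1 a) hwm hT
    rw [ENNReal.ofReal_toReal (hr a).ne] at h
    rw [← h, transProb_eq_expRenewal hr hφ hκ hB ha hT]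
    congr 2
    exact setLIntegral_congr_fun measurableSet_Ioc fun r hr' =>
      transProb_eq_expRenewal hr hφ hκ hB ha hr'.1.le

lemma lintegral_transProb_eq [MeasurableSingletonClass S] {π : Measure S} [SFinite π]
    (hr : IsRateKernel μ) (hfin : ∫⁻ a, totalRate μ a ∂π < ∞) (hbal : Balanced π μ)
    (hφ : Measurable (Function.uncurry φ))
    (hκ : ∀ a, (volume : Measure I).map (φ a) = jumpKernel μ a) {B : Set S} (hB : MeasurableSet B)
    {T : ℝ} (hT : 0 ≤ T) : ∫⁻ a, transProb μ φ B (ENNReal.ofReal T) a ∂π = π B := by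
  have := isMarkovKernel_jumpKernel hr
  have hm1 : Measurable fun p : S × ℝ => transProb μ φ B (ENNReal.ofReal p.2) p.1 :=
    measurable_transProb_comp hφ hB (by fun_prop) measurable_fst
  have hm2 := measurable_afterJump_uncurry (μ := μ) (κ := jumpKernel μ) hφ hB
  have hrate : Measurable fun p : S × ℝ => totalRate μ p.1 :=
    (measurable_totalRate μ).comp measurable_fst
  have h1 : ∫⁻ a, totalRate μ a * (∫⁻ r in Set.Ioc 0 T, transProb μ φ B (ENNReal.ofReal r) a) ∂π =
      ∫⁻ r in Set.Ioc 0 T, ∫⁻ a, totalRate μ a * transProb μ φ B (ENNReal.ofReal r) a ∂π := by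
    simp_rw [← lintegral_const_mul' _ _ (hr _).ne]
    exact lintegral_lintegral_swap
      (f := fun a r => totalRate μ a * transProb μ φ B (ENNReal.ofReal r) a)
      (hrate.mul hm1).aemeasurable
  have h2 : ∫⁻ a, totalRate μ a * (∫⁻ r in Set.Ioc 0 T, afterJump μ φ (jumpKernel μ) B a r) ∂π =
      ∫⁻ r in Set.Ioc 0 T, ∫⁻ a, totalRate μ a * afterJump μ φ (jumpKernel μ) B a r ∂π := by
    simp_rw [← lintegral_const_mul' _ _ (hr _).ne]
    exact lintegral_lintegral_swap
      (f := fun a r => totalRate μ a * afterJump μ φ (jumpKernel μ) B a r)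
      (hrate.mul hm2).aemeasurable
  -- `λ · κp_r = μp_r`, and balance with test function `p_r` turns its `π`-integral into that of `λ
  -- p_r`.
  have h3 : ∀ r : ℝ, ∫⁻ a, totalRate μ a * afterJump μ φ (jumpKernel μ) B a r ∂π =
      ∫⁻ a, totalRate μ a * transProb μ φ B (ENNReal.ofReal r) a ∂π := fun r => by
    rw [← hbal _ (measurable_transProb hφ hB _)]
    exact lintegral_congr fun a => rate_mul_lintegral_jumpKernel hr a _
  simp_rw [h3] at h2
  -- The common term is at most `T ∫ λ dπ`, so it can be cancelled.
  have hne : ∫⁻ r in Set.Ioc 0 T,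
      ∫⁻ a, totalRate μ a * transProb μ φ B (ENNReal.ofReal r) a ∂π ≠ ∞ := by
    refine ne_top_of_le_ne_top (b := ∫⁻ _r in Set.Ioc 0 T, ∫⁻ a, totalRate μ a ∂π) ?_ ?_
    · rw [setLIntegral_const]
      exact ENNReal.mul_ne_top hfin.ne (by simp)
    · exact lintegral_mono fun r => lintegral_mono fun a => mul_le_of_le_one_right zero_le prob_le_one
  have h := lintegral_congr (μ := π) fun a => transProb_backward hr hφ hκ hB a hT
  rw [lintegral_add_left (measurable_transProb hφ hB _), h1,
    lintegral_add_left (measurable_one.indicator hB), h2, lintegral_indicator_one hB] at h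
  exact (ENNReal.add_left_inj hne).1 h

end Stationary

/-! ### The trajectory is a non-explosive Markov jump process -/

section Construction

variable {S : Type*} [MeasurableSpace S] {φ : S → I → S} {μ : Kernel S S}

lemma map_driverLaw_hold_fun (a : S) :
    (driverLaw S a).map (fun ω k => hold k ω) = Measure.infinitePi fun _ : ℕ => expMeasure 1 := by
  have h : Measurable fun ω : Driver S => fun k => hold k ω :=
    measurable_pi_lambda _ measurable_hold
  rw [driverLaw_apply, Measure.map_map h measurable_prodMk_left]
  have : (fun (ω : Driver S) k => hold k ω) ∘ Prod.mk a = Prod.snd := rfl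
  rw [this, noiseLaw, Measure.map_snd_prod, measure_univ, one_smul]

lemma map_driverLaw_hold (a : S) (k : ℕ) : (driverLaw S a).map (hold k) = expMeasure 1 := by
  have h : Measurable fun ω : Driver S => fun k => hold k ω :=
    measurable_pi_lambda _ measurable_hold
  have := Measure.map_map (μ := driverLaw S a) (measurable_pi_apply k) h
  rw [map_driverLaw_hold_fun, Measure.infinitePi_map_eval] at this
  exact this.symm

/-- The chain uses only the uniform variables; this makes it independent of the holding times. -/
lemma chain_congr {S : Type*} (φ : S → I → S) (n : ℕ) (a : S) (U : ℕ → I) (G G' : ℕ → ℝ) :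
    chain φ n (a, (U, G)) = chain φ n (a, (U, G')) := by
  induction n generalizing a U G G' with
  | zero => rfl
  | succ n ih => exact ih _ _ _ _

lemma indepFun_hold_chain (hφ : Measurable (Function.uncurry φ)) (a : S) :
    IndepFun (fun ω k => hold k ω) (fun ω n => chain φ n ω) (driverLaw S a) := by
  have h1 : Measurable fun ω : Driver S => fun k => hold k ω :=
    measurable_pi_lambda _ measurable_hold
  have h2 : Measurable fun ω : Driver S => fun n => chain φ n ω :=
    measurable_pi_lambda _ (measurable_chain hφ)
  have h2' : Measurable fun U : ℕ → I => fun n => chain φ n (a, (U, 0)) :=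
    h2.comp (f := fun U : ℕ → I => (a, (U, (0 : ℕ → ℝ)))) (by fun_prop)
  have hind : IndepFun (fun q : (ℕ → I) × (ℕ → ℝ) => q.2)
      (fun q n => chain φ n (a, (q.1, 0))) noiseLaw :=
    (indepFun_prod (μ := Measure.infinitePi fun _ : ℕ => (volume : Measure I))
      (ν := Measure.infinitePi fun _ : ℕ => expMeasure 1) h2' measurable_id).symm
  rw [indepFun_iff_measure_inter_preimage_eq_mul] at hind ⊢
  intro s t hs ht
  rw [driverLaw_apply, Measure.map_apply measurable_prodMk_left ((h1 hs).inter (h2 ht)),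
    Measure.map_apply measurable_prodMk_left (h1 hs),
    Measure.map_apply measurable_prodMk_left (h2 ht)]
  have e : Prod.mk a ⁻¹' ((fun (ω : Driver S) n => chain φ n ω) ⁻¹' t) =
      (fun (q : (ℕ → I) × (ℕ → ℝ)) n => chain φ n (a, (q.1, 0))) ⁻¹' t := by
    ext q
    have : (fun n => chain φ n (a, q)) = fun n => chain φ n (a, (q.1, 0)) :=
      funext fun n => chain_congr φ n a q.1 q.2 0
    simp only [Set.mem_preimage, this]
  rw [Set.preimage_inter, e]
  exact hind s t hs ht

lemma iIndepFun_hold (a : S) : iIndepFun (hold (S := S)) (driverLaw S a) := by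
  rw [iIndepFun_iff_map_fun_eq_infinitePi_map measurable_hold, map_driverLaw_hold_fun]
  simp_rw [map_driverLaw_hold]

lemma hasJumpHoldStructure_state [Nonempty S] [MeasurableSingletonClass S] (hr : IsRateKernel μ)
    (hφ : Measurable (Function.uncurry φ))
    (hκ : ∀ a, (volume : Measure I).map (φ a) = jumpKernel μ a) :
    HasJumpHoldStructure μ (driverLaw S) (fun t : ℝ≥0 => state μ φ t) (chain φ) hold where
  chain a := by
    have := isMarkovKernel_jumpKernel hr
    exact isMarkovChainFrom_chain hφ hκ a
  measurable_hold := measurable_hold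
  hold_law := map_driverLaw_hold
  hold_indep := iIndepFun_hold
  indep := indepFun_hold_chain hφ
  eq_chain _ := Eventually.of_forall fun _ _ _ h1 h2 => state_eq_chain h1 h2

lemma state_eventually_const [Nonempty S] {ω : Driver S}
    (hω : Tendsto (fun n => epoch μ φ n ω) atTop (𝓝 ∞)) (t : ℝ≥0) :
    (∀ᶠ r : ℝ≥0 in 𝓝[≥] t, state μ φ r ω = state μ φ t ω) ∧
      ∃ b : S, ∀ᶠ r : ℝ≥0 in 𝓝[<] t, state μ φ r ω = b := by
  classical
  have hex : ∃ n, (t : ℝ≥0∞) < epoch μ φ (n + 1) ω :=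
    (((tendsto_add_atTop_iff_nat 1).2 hω).eventually (lt_mem_nhds ENNReal.coe_lt_top)).exists
  have hcoe : Tendsto (fun r : ℝ≥0 => (r : ℝ≥0∞)) (𝓝 t) (𝓝 t) :=
    ENNReal.continuous_coe.tendsto t
  constructor
  · obtain ⟨n, h1, h2⟩ := exists_epoch_le_lt hex
    filter_upwards [self_mem_nhdsWithin,
      mem_nhdsWithin_of_mem_nhds (hcoe.eventually (gt_mem_nhds h2))] with r hr hr2
    rw [state_eq_chain h1 h2, state_eq_chain (h1.trans (ENNReal.coe_le_coe.2 hr)) hr2]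
  · rcases eq_or_ne t 0 with rfl | ht
    · refine ⟨Classical.arbitrary S, ?_⟩
      filter_upwards [self_mem_nhdsWithin] with r hr
      exact absurd (Set.mem_Iio.1 hr) not_lt_zero
    -- For the left limit the non-strict inequality is the right one: the least such `n` has `τ_n <
    -- t ≤ τ_{n+1}`, so the state is `Y_n` just before `t`, even if `t` is a jump time.
    · have hex' : ∃ n, (t : ℝ≥0∞) ≤ epoch μ φ (n + 1) ω := hex.imp fun _ h => h.le
      have hlt : epoch μ φ (Nat.find hex') ω < t := by
        rcases hn : Nat.find hex' with _ | m
        · rw [epoch_zero]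
          exact ENNReal.coe_pos.2 (pos_iff_ne_zero.2 ht)
        · exact not_le.1 (Nat.find_min hex' (by omega : m < Nat.find hex'))
      refine ⟨chain φ (Nat.find hex') ω, ?_⟩
      filter_upwards [self_mem_nhdsWithin,
        mem_nhdsWithin_of_mem_nhds (hcoe.eventually (lt_mem_nhds hlt))] with r hr hr2
      exact state_eq_chain (le_of_lt hr2)
        ((ENNReal.coe_lt_coe.2 hr).trans_le (Nat.find_spec hex'))

lemma isNonexplosiveMarkovJumpProcess_state [Nonempty S] [MeasurableSingletonClass S]
    (hr : IsRateKernel μ) (hφ : Measurable (Function.uncurry φ))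
    (hκ : ∀ a, (volume : Measure I).map (φ a) = jumpKernel μ a)
    (hne : ∀ a, explosionDecay μ a = 0) :
    IsNonexplosiveMarkovJumpProcess μ (driverLaw S) (fun t : ℝ≥0 => state μ φ t) where
  isMarkovKernel := inferInstance
  measurable t := measurable_state_right hφ t
  start a := by
    have hpos : ∀ᵐ ω ∂(driverLaw S a), 0 < hold 0 ω := by
      have h := ae_pos_expMeasure
      rw [← map_driverLaw_hold a 0] at h
      exact ae_of_ae_map (measurable_hold 0).aemeasurable h
    filter_upwards [ae_fst_eq a, hpos] with ω hω hg
    refine Eq.trans (state_of_lt_stay ?_) hω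
    exact ENNReal.div_pos (ENNReal.ofReal_pos.2 hg).ne' (hr ω.1).ne
  paths a := by
    filter_upwards [ae_tendsto_epoch hφ hκ (hne a)] with ω hω t using state_eventually_const hω t
  markov a s t B hB := by
    have := isMarkovKernel_jumpKernel hr
    exact state_markov hr hφ hκ (ae_tendsto_epoch hφ hκ (hne a)) s t hB
  rates := ⟨chain φ, hold, hasJumpHoldStructure_state hr hφ hκ,
    fun a => ae_tendsto_epoch hφ hκ (hne a)⟩

end Construction

end JumpProcess

theorem theorem1 {S : Type u} [TopologicalSpace S]
    [PolishSpace S] [MeasurableSpace S] [BorelSpace S]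
    (π : Measure S) [IsProbabilityMeasure π]
    (𝔰 : S → S) (h_inv : Function.Involutive 𝔰) (h_pres : MeasurePreserving 𝔰 π π)
    (μ : Kernel S S) (h_rate : JumpProcess.IsRateKernel μ)
    (h_fin : ∫⁻ a, JumpProcess.totalRate μ a ∂π < ∞)
    (h_skew : JumpProcess.HalfSkewBalance π 𝔰 μ)
    (h_semi : ∀ a, JumpProcess.totalRate μ a = JumpProcess.totalRate μ (𝔰 a)) :
    ∃ μ' : Kernel S S, JumpProcess.IsRateKernel μ' ∧ (∀ᵐ a ∂π, μ' a = μ a) ∧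
      ∃ (Ω : Type u) (_ : MeasurableSpace Ω) (P : Kernel S Ω) (Z : ℝ≥0 → Ω → S),
        JumpProcess.IsNonexplosiveMarkovJumpProcess μ' P Z ∧
        JumpProcess.IsStationary π P Z := by
  have hS : Nonempty S := π.nonempty_of_neZero
  have hbal := JumpProcess.balanced_of_halfSkewBalance h_pres h_rate h_fin h_skew h_semi
  have hr := JumpProcess.isRateKernel_nonexplosive h_rate
  have hae : ∀ᵐ a ∂π, JumpProcess.nonexplosive μ a = μ a := by
    filter_upwards [JumpProcess.explosionDecay_ae_eq_zero h_rate h_fin hbal] with a ha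
    exact JumpProcess.nonexplosive_of_eq ha
  have hfin : ∫⁻ a, JumpProcess.totalRate (JumpProcess.nonexplosive μ) a ∂π < ∞ := by
    refine lt_of_eq_of_lt (lintegral_congr_ae ?_) h_fin
    filter_upwards [hae] with a ha
    rw [JumpProcess.totalRate, JumpProcess.totalRate, ha]
  have hmarkov := JumpProcess.isMarkovKernel_jumpKernel hr
  -- A Markov kernel into a standard Borel space is the law of a jointly measurable function of the
  -- state and a uniform variable.
  obtain ⟨φ, hφ, hκ⟩ := Kernel.exists_measurable_map_eq_unitInterval
    (JumpProcess.jumpKernel (JumpProcess.nonexplosive μ))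
  refine ⟨JumpProcess.nonexplosive μ, hr, hae, JumpProcess.Driver S, inferInstance,
    JumpProcess.driverLaw S, fun t => JumpProcess.state (JumpProcess.nonexplosive μ) φ t,
    JumpProcess.isNonexplosiveMarkovJumpProcess_state hr hφ hκ
      (JumpProcess.explosionDecay_nonexplosive h_rate), fun t B hB => ?_⟩
  have h := JumpProcess.lintegral_transProb_eq hr hfin (hbal.congr hae) hφ hκ hB t.coe_nonneg
  rw [ENNReal.ofReal_coe_nnreal] at h
  exact h
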